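/- Let $M=(\mathcal S,\mathcal A,P,R,\gamma,d_0)$ be a discounted Markov decision process with finite $\mathcal S,\mathcal A$, rewards $R:\mathcal S\times\mathcal A\to[0,R_{\max}]$, discount $\gamma\in[0,1)$ and initial distribution $d_0$; put $V_{\max}=R_{\max}/(1-\gamma)$. Let $\mu$ be a distribution on $\mathcal S\times\mathcal A$ satisfying the data-coverage condition with constant $C$: $\mu(s,a)>0$ for all $(s,a)$, and there are constants $C_{\mathcal A},C_{\mathcal S}\ge 1$ with $C=C_{\mathcal S}C_{\mathcal A}$ such that $\mu(a|s)\ge 1/C_{\mathcal A}$, $P(s'|s,a)/\mu(s')\le C_{\mathcal S}$ and $d_0(s)/\mu(s)\le C_{\mathcal S}$ for all $s,a,s'$, where $\mu(s)$ is the state marginal and $\mu(a|s)=\mu(s,a)/\mu(s)$. Let $\pi$ be a (possibly stochastic) policy, $Q^\pi(s,a)=\sum_{t\ge0}\gamma^t\,\mathbb E[R(s_t,a_t)\mid s_0=s,a_0=a,\pi]$ its value function, and $Q^1,\dots,Q^L:\mathcal S\times\mathcal A\to[0,V_{\max}]$ candidates ($L\ge1$). The dataset $D$ consists of $n$ i.i.d.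 tuples $(s,a,r,s')$ with $(s,a)\sim\mu$, $r=R(s,a)$, $s'\sim P(\cdot|s,a)$. Let $\varepsilon>0$, $\delta\in(0,1)$ and $\varepsilon_{\mathrm{dct}}=\varepsilon R_{\max}/(8\sqrt C)$. Fix a discretization of $[0,V_{\max}]$ with resolution $\varepsilon_{\mathrm{dct}}$, that is, a rounding map that moves every point of $[0,V_{\max}]$ by at most $\varepsilon_{\mathrm{dct}}$ and takes at most $\lceil V_{\max}/\varepsilon_{\mathrm{dct}}\rceil+1$ values there; let $\overline{Q^i}$ be $Q^i$ followed by this map. Let $\mathcal G_{i,j}$ be the set of functions $\mathcal S\times\mathcal A\to[0,V_{\max}]$ that are constant on each set on which the pair $(\overline{Q^i},\overline{Q^j})$ is constant. Let $\widehat{\mathcal T}^\pi_{\mathcal G_{i,j}}Q^i$ be a minimizer over $g\in\mathcal G_{i,j}$ of $\frac1n\sum_{(s,a,r,s')\in D}\big(g(s,a)-r-\gamma\,\mathbb E_{a'\sim\pi(\cdot|s')}[Q^i(s',a')]\big)^2$, and let $\hat Q$ be a candidate $Q^i$ minimizing the empirical BVFT-PE loss $\max_j\|Q^i-\widehat{\mathcal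 T}^\pi_{\mathcal G_{i,j}}Q^i\|_{2,D}$, where $\|f\|_{2,D}^2=\frac1n\sum_{(s,a)\in D}f(s,a)^2$. There is a universal constant $K>0$ such that, whenever $$n\ \ge\ \frac{K\,C^2}{\varepsilon^4(1-\gamma)^4}\,\ln\frac{K\sqrt C\,L}{\varepsilon(1-\gamma)\delta},$$ i.e. with $\tilde O\!\left(\frac{C^2\ln(L/\delta)}{\varepsilon^4(1-\gamma)^4}\right)$ samples, with probability at least $1-\delta$ every such $\hat Q$ satisfies $$\sup_{\nu:\ \|\nu/\mu\|_\infty\le C}\|\hat Q-Q^\pi\|_{2,\nu}\ \le\ \varepsilon\cdot\frac{R_{\max}}{1-\gamma}+\frac{(2+4\sqrt C)\,\min_{l}\|Q^l-Q^\pi\|_\infty}{1-\gamma},$$ where $\nu$ ranges over distributions on $\mathcal S\times\mathcal A$ and $\|f\|_{2,\nu}^2=\mathbb E_\nu[f^2]$. -/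

import Mathlib

open MeasureTheory

noncomputable section

/-- A finite discounted Markov decision process with states `S` and actions `A`. -/
structure FiniteMDP (S A : Type*) where
  /-- transition function -/
  P : S → A → PMF S
  /-- reward function -/
  R : S → A → ℝ
  /-- upper bound on the rewards -/
  Rmax : ℝ
  /-- discount factor -/
  γ : ℝ
  /-- initial state distribution -/
  d₀ : PMF S
  R_nonneg : ∀ s a, 0 ≤ R s a
  R_le : ∀ s a, R s a ≤ Rmax
  γ_nonneg : 0 ≤ γ
  γ_lt_one : γ < 1

/-- A discretization of `[0, V]` with resolution `η`: a rounding map that moves every point of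
`[0, V]` by at most `η` and takes at most `⌈V / η⌉ + 1` values on `[0, V]`. Rounding down, up or to
the nearest multiple of `η` and rounding to the midpoints of bins of width `η` or `2 η` are all of
this kind. -/
structure IsDiscretization (disc : ℝ → ℝ) (V η : ℝ) : Prop where
  abs_sub_le : ∀ x ∈ Set.Icc 0 V, |disc x - x| ≤ η
  finite : (disc '' Set.Icc 0 V).Finite
  ncard_le : (disc '' Set.Icc 0 V).ncard ≤ ⌈V / η⌉₊ + 1

/-- Functions on `X` with values in `[0, V]` that are constant on every cell of the partition of
`X` into the fibres of `φ`. -/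
def piecewiseConst {X Y : Type*} (V : ℝ) (φ : X → Y) : Set (X → ℝ) :=
  {g | (∀ x, g x ∈ Set.Icc 0 V) ∧ ∀ x y, φ x = φ y → g x = g y}

/-- The `L²(ν)` norm on a finite space. -/
def l2norm {X : Type*} [Fintype X] (ν : PMF X) (f : X → ℝ) : ℝ :=
  √(∑ x, (ν x).toReal * f x ^ 2)

/-- `E_{a ∼ π(·|s)} [Q(s, a)]`. -/
def policyValue {S A : Type*} [Fintype A] (π : S → PMF A) (Q : S × A → ℝ) (s : S) : ℝ :=
  ∑ a, (π s a).toReal * Q (s, a)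

/-! A dataset of size `n` is `D : Fin n → S × A × ℝ × S`, a list of tuples `(s, a, r, s')`. -/

/-- The empirical norm `‖f‖_{2,D}`. -/
def empNorm {S A : Type*} {n : ℕ} (D : Fin n → S × A × ℝ × S) (f : S × A → ℝ) : ℝ :=
  √((1 / (n : ℝ)) * ∑ k, f ((D k).1, (D k).2.1) ^ 2)

/-- Empirical squared regression loss of `g` against the targets `r + γ E_{a' ∼ π(·|s')} Q(s', a')`. -/
def empRisk {S A : Type*} [Fintype A] (γ : ℝ) (π : S → PMF A) {n : ℕ}
    (D : Fin n → S × A × ℝ × S) (Q g : S × A → ℝ) : ℝ :=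
  (1 / (n : ℝ)) * ∑ k, (g ((D k).1, (D k).2.1) - (D k).2.2.1
    - γ * policyValue π Q (D k).2.2.2) ^ 2

/-- `g` is an empirical projected Bellman update of `Q` for the policy `π` and the class `G`:
a minimizer of the empirical squared loss over `G`. -/
def IsEmpProjBellman {S A : Type*} [Fintype A] (γ : ℝ) (π : S → PMF A) {n : ℕ}
    (D : Fin n → S × A × ℝ × S) (G : Set (S × A → ℝ)) (Q g : S × A → ℝ) : Prop :=
  g ∈ G ∧ IsMinOn (empRisk γ π D Q) G g

/-- The class `G_{i,j}`: piecewise constant functions for the partition induced by the pair of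
discretized candidates `Q i`, `Q j`. -/
def pairClass {S A : Type*} {L : ℕ} (V : ℝ) (disc : ℝ → ℝ) (Q : Fin L → S × A → ℝ)
    (i j : Fin L) : Set (S × A → ℝ) :=
  piecewiseConst V (fun x => (disc (Q i x), disc (Q j x)))

/-- The empirical loss `max_j ‖Q i - T i j‖_{2,D}` of candidate `i`, where `T i j` is the empirical
projected Bellman update of `Q i` over the class `G_{i,j}`. -/
def bvftLoss {S A : Type*} {L n : ℕ} (D : Fin n → S × A × ℝ × S)
    (Q : Fin L → S × A → ℝ) (T : Fin L → Fin L → S × A → ℝ) (i : Fin L) : ℝ :=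
  ⨆ j, empNorm D (Q i - T i j)

/-- `l` is a possible output of BVFT-PE on the data `D`: it minimizes the empirical loss, computed
with some choice of the empirical projected Bellman updates. -/
def IsBVFTPEOutput {S A : Type*} [Fintype A] (γ V : ℝ) (disc : ℝ → ℝ) (π : S → PMF A) {L n : ℕ}
    (Q : Fin L → S × A → ℝ) (D : Fin n → S × A × ℝ × S) (l : Fin L) : Prop :=
  ∃ T : Fin L → Fin L → S × A → ℝ,
    (∀ i j, IsEmpProjBellman γ π D (pairClass V disc Q i j) (Q i) (T i j)) ∧
    ∀ i, bvftLoss D Q T l ≤ bvftLoss D Q T i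

namespace FiniteMDP

variable {S A : Type*}

/-- The maximal value `R_max / (1 - γ)`. -/
def Vmax (M : FiniteMDP S A) : ℝ := M.Rmax / (1 - M.γ)

/-- The law of `(s_t, a_t)` when the trajectory starts from the pair `x` and then follows `π`. -/
def law (M : FiniteMDP S A) (π : S → PMF A) (x : S × A) : ℕ → PMF (S × A)
  | 0 => PMF.pure x
  | t + 1 => (M.law π x t).bind fun y =>
      (M.P y.1 y.2).bind fun s' => (π s').map fun a' => (s', a')

/-- The value function `Q^π(s, a) = ∑_t γ^t E[R(s_t, a_t)]` with `(s_0, a_0) = (s, a)`. -/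
def qPi [Fintype S] [Fintype A] (M : FiniteMDP S A) (π : S → PMF A) (x : S × A) : ℝ :=
  ∑' t : ℕ, M.γ ^ t * ∑ y, (M.law π x t y).toReal * M.R y.1 y.2

/-- The data coverage condition with constant `C = C_S C_A`; here `μ.map Prod.fst` is the marginal
of `μ` on states. -/
def Coverage (M : FiniteMDP S A) (μ : PMF (S × A)) (C : ℝ) : Prop :=
  (∀ s a, 0 < μ (s, a)) ∧
  ∃ CS CA : ℝ, 1 ≤ CA ∧ 1 ≤ CS ∧ C = CS * CA ∧
    (∀ s a, 1 / CA ≤ (μ (s, a)).toReal / (μ.map Prod.fst s).toReal) ∧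
    (∀ s a s', (M.P s a s').toReal / (μ.map Prod.fst s').toReal ≤ CS) ∧
    (∀ s, (M.d₀ s).toReal / (μ.map Prod.fst s).toReal ≤ CS)

/-- The law of one data tuple: `(s, a) ∼ μ`, `r = R(s, a)`, `s' ∼ P(·|s, a)`. -/
def sampleLaw (M : FiniteMDP S A) (μ : PMF (S × A)) : PMF (S × A × ℝ × S) :=
  μ.bind fun x => (M.P x.1 x.2).map fun s' => (x.1, x.2, M.R x.1 x.2, s')

/-- The law of a dataset of `n` i.i.d. tuples. -/
def dataLaw [MeasurableSpace S] [MeasurableSpace A] (M : FiniteMDP S A) (μ : PMF (S × A))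
    (n : ℕ) : Measure (Fin n → S × A × ℝ × S) :=
  Measure.pi fun _ => (M.sampleLaw μ).toMeasure

end FiniteMDP

end

/-! Write `Π` for the `L²(μ)` projection onto functions constant on the cells of a partition, `T`
for the Bellman operator of `π`, `P` for its transition kernel, and `h = q - Q^π`. Then `h = (q -
ΠTq) + γ ΠP h + (ΠQ^π - Q^π)`. Coverage gives `P(x, y) ≤ C μ(y)`, and averaging over cells preserves
this, so `ΠP` is a Markov kernel sending every distribution to one with density at most `C` relative
to `μ`. Taking the supremum of `‖h‖` over all such distributions closes the recursion: `(1 - γ)‖h‖ ≤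
√C ‖q - ΠTq‖_μ + b`, where `b` bounds the oscillation of `Q^π` on cells
(`Coverage.wnorm_sub_qPi_le`).

For the output `l` and a best candidate `m`, the cells of the pair `(l, m)` make `Q^π` nearly
constant because `Q m` is. It remains to bound the projected residual of `Q l` there. Minimality of
`l` compares its empirical loss with that of `m`, which is small since `‖Q m - T(Q m)‖_μ ≤ 2‖Q m -
Q^π‖`.

The passage between data and population needs no covering of the function classes. On the data, the
regression minimizer is the cell average of the targets (`IsEmpProjBellman.comp_dataPair`). Since `Q
i` is nearly constant on cells, the loss is, up to `2η`, the norm of the projected residual, that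
is, the square root of the sum over cells of (cell sum)² / (cell mass) (`wnorm_cellAvg`).
Bernstein's inequality with variance proxy equal to the cell mass controls all cells; the two norms
then agree up to a factor `√2` and an additive `5 V √τ` times the root of the number of cells
(`wnorm_cellAvg_compare`). Balancing this term against `ε` forces `√τ` of order `ε²(1-γ)²/C`, which
is the source of `ε⁻⁴`. -/

/-! ### Weighted `L²` norms. -/

/-- The weighted `L²` seminorm `√(∑ wᵢ fᵢ²)` on a finite type. -/
noncomputable def wnorm {ι : Type*} [Fintype ι] (w f : ι → ℝ) : ℝ :=
  √(∑ i, w i * f i ^ 2)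

section WeightedNorm

variable {ι : Type*} [Fintype ι] {w f g : ι → ℝ}

lemma wnorm_eq_norm (hw : ∀ i, 0 ≤ w i) :
    wnorm w f = ‖WithLp.toLp 2 (fun i => √(w i) * f i)‖ := by
  rw [EuclideanSpace.norm_eq, wnorm]
  congr 1
  refine Finset.sum_congr rfl fun i _ => ?_
  simp [mul_pow, Real.sq_sqrt (hw i)]

lemma wnorm_add_le (hw : ∀ i, 0 ≤ w i) : wnorm w (f + g) ≤ wnorm w f + wnorm w g := by
  rw [wnorm_eq_norm hw, wnorm_eq_norm hw, wnorm_eq_norm hw]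
  refine le_trans (le_of_eq ?_) (norm_add_le _ _)
  congr 1
  ext i
  simp [mul_add]

lemma wnorm_const_mul (c : ℝ) : wnorm w (fun i => c * f i) = |c| * wnorm w f := by
  rw [wnorm, wnorm, ← Real.sqrt_sq_eq_abs, ← Real.sqrt_mul (sq_nonneg c), Finset.mul_sum]
  congr 1
  exact Finset.sum_congr rfl fun i _ => by ring

lemma wnorm_mono (hw : ∀ i, 0 ≤ w i) (h : ∀ i, |f i| ≤ |g i|) : wnorm w f ≤ wnorm w g :=
  Real.sqrt_le_sqrt <| Finset.sum_le_sum fun i _ =>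
    mul_le_mul_of_nonneg_left (sq_le_sq.2 (h i)) (hw i)

lemma wnorm_const (hw : ∑ i, w i = 1) {b : ℝ} (hb : 0 ≤ b) : wnorm w (fun _ => b) = b := by
  rw [wnorm, ← Finset.sum_mul, hw, one_mul, Real.sqrt_sq hb]

lemma wnorm_le_of_abs_le (hw : ∀ i, 0 ≤ w i) (hw1 : ∑ i, w i = 1) {b : ℝ} (hb : 0 ≤ b)
    (h : ∀ i, |f i| ≤ b) : wnorm w f ≤ b := by
  rw [← wnorm_const hw1 hb]
  exact wnorm_mono hw fun i => (h i).trans (le_abs_self b)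

lemma wnorm_le_sqrt_mul {w' : ι → ℝ} {C : ℝ} (hC : 0 ≤ C) (h : ∀ i, w i ≤ C * w' i) :
    wnorm w f ≤ √C * wnorm w' f := by
  rw [wnorm, wnorm, ← Real.sqrt_mul hC, Finset.mul_sum]
  refine Real.sqrt_le_sqrt <| Finset.sum_le_sum fun i _ => ?_
  rw [← mul_assoc]
  exact mul_le_mul_of_nonneg_right (h i) (sq_nonneg _)

/-- A Markov kernel maps the weights `w` to weights for which the image of `f` is no longer. -/
lemma wnorm_kernel_le (hw : ∀ i, 0 ≤ w i) {k : ι → ι → ℝ} (hk : ∀ i j, 0 ≤ k i j)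
    (hk1 : ∀ i, ∑ j, k i j = 1) :
    wnorm w (fun i => ∑ j, k i j * f j) ≤ wnorm (fun j => ∑ i, w i * k i j) f := by
  refine Real.sqrt_le_sqrt ?_
  have h1 : ∀ i, (∑ j, k i j * f j) ^ 2 ≤ ∑ j, k i j * f j ^ 2 := fun i =>
    Real.pow_arith_mean_le_arith_mean_pow_of_even _ _ _ (fun j _ => hk i j) (hk1 i) even_two
  calc ∑ i, w i * (∑ j, k i j * f j) ^ 2 ≤ ∑ i, w i * ∑ j, k i j * f j ^ 2 :=
        Finset.sum_le_sum fun i _ => mul_le_mul_of_nonneg_left (h1 i) (hw i)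
    _ = ∑ j, (∑ i, w i * k i j) * f j ^ 2 := by
        simp_rw [Finset.mul_sum, Finset.sum_mul]
        rw [Finset.sum_comm]
        exact Finset.sum_congr rfl fun _ _ => Finset.sum_congr rfl fun _ _ => by ring

lemma wnorm_one_le {s κ : ℝ} (hs : 0 ≤ s) (hκ : 0 ≤ κ) (h : ∀ i, |f i| ≤ s * |g i| + κ) :
    wnorm 1 f ≤ s * wnorm 1 g + κ * √(Fintype.card ι) := by
  have h1 : wnorm 1 f ≤ wnorm 1 ((fun i => s * |g i|) + fun _ : ι => κ) :=
    wnorm_mono (fun _ => zero_le_one) fun i => (h i).trans (le_abs_self _)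
  refine h1.trans ((wnorm_add_le fun _ => zero_le_one).trans (le_of_eq ?_))
  rw [wnorm_const_mul, abs_of_nonneg hs]
  congr 1
  · simp [wnorm]
  · simp only [wnorm, one_mul, Finset.sum_const, Finset.card_univ, nsmul_eq_mul]
    rw [Real.sqrt_mul (Nat.cast_nonneg _), Real.sqrt_sq hκ, mul_comm]

end WeightedNorm

/-! ### Cell averages as orthogonal projections. -/

/-- The `w`-weighted sum of `f` over the fibre of `ψ` above `c`. -/
noncomputable def cellSum {ι Y : Type*} [Fintype ι] [DecidableEq Y] (w : ι → ℝ) (ψ : ι → Y) (f : ι → ℝ)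
    (c : Y) : ℝ :=
  ∑ i with ψ i = c, w i * f i

/-- The total weight of the fibre of `ψ` above `c`. -/
noncomputable def cellMass {ι Y : Type*} [Fintype ι] [DecidableEq Y] (w : ι → ℝ) (ψ : ι → Y) (c : Y) : ℝ :=
  ∑ i with ψ i = c, w i

/-- The `w`-weighted average of `f` over the fibre of `ψ` containing a point: the orthogonal
projection of `f` in `L²(w)` to the functions that are constant on the fibres of `ψ`. -/
noncomputable def cellAvg {ι Y : Type*} [Fintype ι] [DecidableEq Y] (w : ι → ℝ) (ψ : ι → Y) (f : ι → ℝ)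
    (i : ι) : ℝ :=
  cellSum w ψ f (ψ i) / cellMass w ψ (ψ i)

section Cells

variable {ι Y : Type*} [Fintype ι] [DecidableEq Y] {w : ι → ℝ} {ψ : ι → Y} {f g : ι → ℝ}

lemma cellSum_const (b : ℝ) (c : Y) : cellSum w ψ (fun _ => b) c = b * cellMass w ψ c := by
  rw [cellSum, cellMass, ← Finset.sum_mul, mul_comm]

lemma cellSum_sub (c : Y) : cellSum w ψ (f - g) c = cellSum w ψ f c - cellSum w ψ g c := by
  simp [cellSum, mul_sub, Finset.sum_sub_distrib]

lemma cellAvg_sub : cellAvg w ψ (f - g) = cellAvg w ψ f - cellAvg w ψ g := by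
  ext i
  simp [cellAvg, cellSum_sub, sub_div]

lemma cellMass_pos (hw : ∀ i, 0 < w i) (i : ι) : 0 < cellMass w ψ (ψ i) :=
  Finset.sum_pos (fun i _ => hw i) ⟨i, by simp⟩

lemma cellMass_nonneg (hw : ∀ i, 0 ≤ w i) (c : Y) : 0 ≤ cellMass w ψ c :=
  Finset.sum_nonneg fun i _ => hw i

lemma cellSum_mono (hw : ∀ i, 0 ≤ w i) (c : Y) (h : ∀ i, ψ i = c → f i ≤ g i) :
    cellSum w ψ f c ≤ cellSum w ψ g c :=
  Finset.sum_le_sum fun i hi => mul_le_mul_of_nonneg_left (h i (by simpa using hi)) (hw i)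

lemma abs_cellSum_le (hw : ∀ i, 0 ≤ w i) {b : ℝ} (c : Y) (h : ∀ i, |f i| ≤ b) :
    |cellSum w ψ f c| ≤ b * cellMass w ψ c := by
  rw [abs_le, ← neg_mul, ← cellSum_const, ← cellSum_const]
  exact ⟨cellSum_mono hw c fun i _ => (abs_le.1 (h i)).1,
    cellSum_mono hw c fun i _ => (abs_le.1 (h i)).2⟩

lemma cellAvg_mem_Icc (hw : ∀ i, 0 < w i) {a b : ℝ} (i : ι)
    (h : ∀ j, ψ j = ψ i → f j ∈ Set.Icc a b) : cellAvg w ψ f i ∈ Set.Icc a b := by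
  have hm := cellMass_pos (ψ := ψ) hw i
  rw [cellAvg, Set.mem_Icc, le_div_iff₀ hm, div_le_iff₀ hm, ← cellSum_const, ← cellSum_const]
  exact ⟨cellSum_mono (fun i => (hw i).le) _ fun j hj => (h j hj).1,
    cellSum_mono (fun i => (hw i).le) _ fun j hj => (h j hj).2⟩

lemma abs_sub_cellAvg_le (hw : ∀ i, 0 < w i) {b : ℝ} (i : ι)
    (h : ∀ j, ψ j = ψ i → |f i - f j| ≤ b) : |f i - cellAvg w ψ f i| ≤ b := by
  have := cellAvg_mem_Icc (ψ := ψ) (f := f) (a := f i - b) (b := f i + b) hw i fun j hj => by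
    have := abs_le.1 (h j hj)
    constructor <;> linarith
  rw [abs_le]
  constructor <;> linarith [this.1, this.2]

lemma cellAvg_comp (hw : ∀ i, 0 < w i) (h : ∀ i j, ψ i = ψ j → f i = f j) :
    cellAvg w ψ f = f := by
  ext i
  have := abs_sub_cellAvg_le (ψ := ψ) (f := f) (b := 0) hw i fun j hj => by simp [h j i hj]
  linarith [abs_nonpos_iff.1 this]

/-- Averaging acts on the first variable of a kernel only, so projecting the image of `h` amounts to
applying the averaged kernel to `h`. -/
lemma cellAvg_sum_mul {κ : Type*} [Fintype κ] (k : ι → κ → ℝ) (h : κ → ℝ) (i : ι) :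
    cellAvg w ψ (fun j => ∑ y, k j y * h y) i =
      ∑ y, cellAvg w ψ (fun j => k j y) i * h y := by
  simp only [cellAvg, cellSum, div_mul_eq_mul_div, ← Finset.sum_div, Finset.mul_sum,
    Finset.sum_mul]
  rw [Finset.sum_comm]
  simp only [mul_assoc]

lemma cellAvg_const_mul (a : ℝ) : cellAvg w ψ (fun i => a * f i) = fun i => a * cellAvg w ψ f i := by
  ext i
  simp only [cellAvg, cellSum, mul_left_comm _ a, ← Finset.mul_sum, mul_div_assoc]

lemma cellAvg_congr {i j : ι} (h : ψ i = ψ j) : cellAvg w ψ f i = cellAvg w ψ f j := by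
  simp [cellAvg, h]

/-- Moving the norm to the set of cells puts the population projection (over state-action pairs) and
the empirical one (over sample indices) on a common index set, where they can be compared term by
term. -/
lemma wnorm_cellAvg [Fintype Y] (hw : ∀ i, 0 ≤ w i) :
    wnorm w (cellAvg w ψ f) = wnorm 1 (fun c => cellSum w ψ f c / √(cellMass w ψ c)) := by
  rw [wnorm, wnorm, ← Finset.sum_fiberwise Finset.univ ψ]
  congr 1
  refine Finset.sum_congr rfl fun c _ => ?_
  have : ∑ i with ψ i = c, w i * cellAvg w ψ f i ^ 2 =
      cellMass w ψ c * (cellSum w ψ f c / cellMass w ψ c) ^ 2 := by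
    rw [cellMass, Finset.sum_mul]
    refine Finset.sum_congr rfl fun i hi => ?_
    simp only [Finset.mem_filter, Finset.mem_univ, true_and] at hi
    rw [cellAvg, hi, cellMass]
  rw [this, div_pow, div_pow, Real.sq_sqrt (cellMass_nonneg hw c), Pi.one_apply]
  rcases eq_or_ne (cellMass w ψ c) 0 with h | h
  · simp [h]
  · field_simp

/-- `f - cellAvg f` is orthogonal to the functions that are constant on cells. -/
lemma sum_mul_sub_cellAvg_mul_eq_zero (hw : ∀ i, 0 < w i) (hg : ∀ i j, ψ i = ψ j → g i = g j) :
    ∑ i, w i * (f i - cellAvg w ψ f i) * g i = 0 := by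
  have key : ∀ i, ∑ j with ψ j = ψ i, w j * (f j - cellAvg w ψ f j) * g j = 0 := by
    intro i
    have : ∀ j ∈ Finset.univ.filter (fun j => ψ j = ψ i),
        w j * (f j - cellAvg w ψ f j) * g j =
          (w j * f j - w j * cellAvg w ψ f i) * g i := fun j hj => by
      simp only [Finset.mem_filter, Finset.mem_univ, true_and] at hj
      rw [cellAvg_congr hj, hg j i hj]
      ring
    rw [Finset.sum_congr rfl this, ← Finset.sum_mul, Finset.sum_sub_distrib, ← Finset.sum_mul]
    change (cellSum w ψ f (ψ i) - cellMass w ψ (ψ i) * cellAvg w ψ f i) * g i = 0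
    rw [cellAvg, mul_div_cancel₀ _ (cellMass_pos hw i).ne', sub_self, zero_mul]
  rw [← Finset.sum_fiberwise_of_maps_to (t := Finset.univ.image ψ) (g := ψ) (by simp)]
  refine Finset.sum_eq_zero fun c hc => ?_
  obtain ⟨i, -, rfl⟩ := Finset.mem_image.1 hc
  exact key i

/-- Pythagoras for the projection; it yields both contractivity and uniqueness of the least-squares
fit. -/
lemma sum_mul_sub_sq_eq (hw : ∀ i, 0 < w i) (hg : ∀ i j, ψ i = ψ j → g i = g j) :
    ∑ i, w i * (g i - f i) ^ 2 =
      ∑ i, w i * (g i - cellAvg w ψ f i) ^ 2 + ∑ i, w i * (cellAvg w ψ f i - f i) ^ 2 := by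
  have h := sum_mul_sub_cellAvg_mul_eq_zero (f := f) (g := g - cellAvg w ψ f) (ψ := ψ) hw
    fun i j hij => by simp [hg i j hij, cellAvg_congr (w := w) (f := f) hij]
  rw [← sub_eq_zero, ← Finset.sum_add_distrib, ← Finset.sum_sub_distrib,
    ← mul_zero (-2 : ℝ), ← h, Finset.mul_sum]
  refine Finset.sum_congr rfl fun i _ => ?_
  simp only [Pi.sub_apply]
  ring

lemma wnorm_cellAvg_le (hw : ∀ i, 0 < w i) : wnorm w (cellAvg w ψ f) ≤ wnorm w f := by
  refine Real.sqrt_le_sqrt ?_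
  have h := sum_mul_sub_sq_eq (f := f) (g := 0) (ψ := ψ) hw fun _ _ _ => rfl
  simp only [Pi.zero_apply, zero_sub, neg_sq] at h
  rw [h]
  exact le_add_of_nonneg_right <| Finset.sum_nonneg fun i _ =>
    mul_nonneg (hw i).le (sq_nonneg _)

lemma eq_cellAvg_of_sum_le (hw : ∀ i, 0 < w i) (hg : ∀ i j, ψ i = ψ j → g i = g j)
    (h : ∑ i, w i * (g i - f i) ^ 2 ≤ ∑ i, w i * (cellAvg w ψ f i - f i) ^ 2) :
    g = cellAvg w ψ f := by
  rw [sum_mul_sub_sq_eq hw hg] at h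
  have hn : ∀ i ∈ Finset.univ, 0 ≤ w i * (g i - cellAvg w ψ f i) ^ 2 := fun i _ =>
    mul_nonneg (hw i).le (sq_nonneg _)
  have h0 := (Finset.sum_eq_zero_iff_of_nonneg hn).1
    (le_antisymm (by linarith) (Finset.sum_nonneg hn))
  ext i
  have := h0 i (Finset.mem_univ i)
  simpa [(hw i).ne', sub_eq_zero] using this

/-- If `f` oscillates by at most `b` on every cell, then projecting the target `g` of `f` to
the cell-constant functions changes the residual by at most `b`. -/
lemma wnorm_sub_cellAvg_le (hw : ∀ i, 0 < w i) (hw1 : ∑ i, w i = 1) {b : ℝ} (hb : 0 ≤ b)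
    (h : ∀ i j, ψ i = ψ j → |f i - f j| ≤ b) :
    wnorm w (f - cellAvg w ψ g) ≤ b + wnorm w (cellAvg w ψ (f - g)) := by
  have : f - cellAvg w ψ g = (f - cellAvg w ψ f) + cellAvg w ψ (f - g) := by
    rw [cellAvg_sub]; abel
  rw [this]
  refine (wnorm_add_le fun i => (hw i).le).trans (add_le_add_left ?_ _)
  exact wnorm_le_of_abs_le (fun i => (hw i).le) hw1 hb fun i =>
    abs_sub_cellAvg_le hw i fun j hj => h i j hj.symm

/-- The projection fixes `cellAvg w ψ g` and is a contraction. Together with `wnorm_sub_cellAvg_le`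
this lets a loss be exchanged for the norm of a projected residual in both directions. -/
lemma wnorm_cellAvg_sub_le (hw : ∀ i, 0 < w i) :
    wnorm w (cellAvg w ψ (f - g)) ≤ wnorm w (f - cellAvg w ψ g) := by
  have : cellAvg w ψ (f - g) = cellAvg w ψ (f - cellAvg w ψ g) := by
    rw [cellAvg_sub, cellAvg_sub, 
      cellAvg_comp (f := cellAvg w ψ g) hw fun i j => cellAvg_congr]
  rw [this]
  exact wnorm_cellAvg_le hw

end Cells

/-! ### Bernstein's inequality for i.i.d. samples. -/

section Concentration

variable {Z : Type*} [MeasurableSpace Z] {ρ : Measure Z} [IsProbabilityMeasure ρ] {f : Z → ℝ}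

lemma integrable_of_abs_le (hf : Measurable f) {b : ℝ} (h : ∀ z, |f z| ≤ b) : Integrable f ρ :=
  Integrable.of_bound hf.aestronglyMeasurable b (ae_of_all _ h)

/-- Integrate `exp x ≤ 1 + x + x²`, valid for `|x| ≤ 1`, at `x = t f`, then use `1 + u ≤ exp u`; the
linear term cancels against the centring. -/
lemma integral_exp_mul_sub_le (hf : Measurable f) (h1 : ∀ z, |f z| ≤ 1) {p : ℝ}
    (hp : ∫ z, f z ^ 2 ∂ρ ≤ p) {t : ℝ} (ht0 : 0 ≤ t) (ht1 : t ≤ 1) :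
    ∫ z, Real.exp (t * (f z - ∫ y, f y ∂ρ)) ∂ρ ≤ Real.exp (t ^ 2 * p) := by
  set m := ∫ y, f y ∂ρ with hm
  have habs : ∀ z, |t * f z| ≤ 1 := fun z => by
    rw [abs_mul, abs_of_nonneg ht0]
    exact mul_le_one₀ ht1 (abs_nonneg _) (h1 z)
  have hi1 : Integrable f ρ := integrable_of_abs_le hf h1
  have hi2 : Integrable (fun z => f z ^ 2) ρ :=
    integrable_of_abs_le (hf.pow_const 2) (b := 1) fun z => by
      rw [abs_pow]; exact pow_le_one₀ (abs_nonneg _) (h1 z)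
  have hie : Integrable (fun z => Real.exp (t * f z)) ρ :=
    integrable_of_abs_le (by fun_prop) (b := Real.exp 1) fun z => by
      rw [Real.abs_exp]; exact Real.exp_le_exp.2 (abs_le.1 (habs z)).2
  have h : ∫ z, Real.exp (t * f z) ∂ρ ≤ ∫ z, (1 + t * f z + t ^ 2 * f z ^ 2) ∂ρ := by
    refine integral_mono hie
      (((integrable_const 1).add (hi1.const_mul t)).add (hi2.const_mul (t ^ 2))) fun z => ?_
    have := (abs_le.1 (Real.abs_exp_sub_one_sub_id_le (habs z))).2
    simp only
    nlinarith
  have h' : ∫ z, (1 + t * f z + t ^ 2 * f z ^ 2) ∂ρ = 1 + t * m + t ^ 2 * ∫ z, f z ^ 2 ∂ρ := by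
    have hI : Integrable (fun z => 1 + t * f z) ρ := (integrable_const 1).add (hi1.const_mul t)
    rw [integral_add hI (hi2.const_mul (t ^ 2)),
      integral_add (integrable_const 1) (hi1.const_mul t), integral_const_mul, integral_const_mul]
    simp [hm]
  calc ∫ z, Real.exp (t * (f z - m)) ∂ρ = Real.exp (-(t * m)) * ∫ z, Real.exp (t * f z) ∂ρ := by
        rw [← integral_const_mul]
        refine integral_congr_ae (ae_of_all _ fun z => ?_)
        simp only
        rw [← Real.exp_add]
        ring_nf
    _ ≤ Real.exp (-(t * m)) * Real.exp (t * m + t ^ 2 * p) := by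
        refine mul_le_mul_of_nonneg_left ?_ (Real.exp_pos _).le
        rw [h'] at h
        have h2 := mul_le_mul_of_nonneg_left hp (sq_nonneg t)
        have h3 := Real.add_one_le_exp (t * m + t ^ 2 * p)
        linarith
    _ = Real.exp (t ^ 2 * p) := by rw [← Real.exp_add]; ring_nf

/-- One-sided Bernstein inequality for sums of independent copies of a bounded function. -/
lemma measureReal_pi_sum_ge_le (hf : Measurable f) (h1 : ∀ z, |f z| ≤ 1) {p τ : ℝ}
    (hp : ∫ z, f z ^ 2 ∂ρ ≤ p) (hτ : 0 < τ) (n : ℕ) :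
    (Measure.pi fun _ : Fin n => ρ).real
      {D | n * (2 * √(τ * max p τ)) ≤ ∑ k, (f (D k) - ∫ y, f y ∂ρ)} ≤ Real.exp (-(n * τ)) := by
  set m := ∫ y, f y ∂ρ with hm
  set q := max p τ with hq
  have hq0 : 0 < q := hτ.trans_le (le_max_right _ _)
  -- Chernoff parameter: `t √(τ q) = τ` and `t² p ≤ τ`, so the exponent is at most `-2nτ + nτ`.
  -- Replacing `p` by `max p τ` keeps `t ≤ 1`.
  set t := √(τ / q) with ht
  have ht0 : 0 ≤ t := Real.sqrt_nonneg _
  have ht2 : t ^ 2 = τ / q := Real.sq_sqrt (by positivity)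
  have ht1 : t ≤ 1 := Real.sqrt_le_one.2 ((div_le_one hq0).2 (le_max_right _ _))
  have htq : t * √(τ * q) = τ := by
    rw [ht, ← Real.sqrt_mul (by positivity), show τ / q * (τ * q) = τ ^ 2 by field_simp,
      Real.sqrt_sq hτ.le]
  have hint : Integrable (fun D : Fin n → Z => Real.exp (t * ∑ k, (f (D k) - m)))
      (Measure.pi fun _ : Fin n => ρ) := by
    refine integrable_of_abs_le (b := Real.exp (t * ∑ _k : Fin n, (1 - m))) (by fun_prop) fun D => ?_
    rw [Real.abs_exp]
    refine Real.exp_le_exp.2 (mul_le_mul_of_nonneg_left (Finset.sum_le_sum fun k _ => ?_) ht0)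
    linarith [(abs_le.1 (h1 (D k))).2]
  refine (ProbabilityTheory.measure_ge_le_exp_mul_mgf _ ht0 hint).trans ?_
  have hmgf : ProbabilityTheory.mgf (fun D : Fin n → Z => ∑ k, (f (D k) - m))
      (Measure.pi fun _ : Fin n => ρ) t = (∫ z, Real.exp (t * (f z - m)) ∂ρ) ^ n := by
    have := integral_fintype_prod_eq_pow (μ := ρ) (ι := Fin n)
      (fun z => Real.exp (t * (f z - m)))
    rw [Fintype.card_fin] at this
    rw [← this, ProbabilityTheory.mgf]
    refine integral_congr_ae (ae_of_all _ fun D => ?_)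
    simp only
    rw [Finset.mul_sum, Real.exp_sum]
  rw [hmgf]
  have h := pow_le_pow_left₀ (integral_nonneg fun z => (Real.exp_pos _).le)
    (integral_exp_mul_sub_le hf h1 hp ht0 ht1) n
  refine (mul_le_mul_of_nonneg_left h (Real.exp_pos _).le).trans ?_
  rw [← Real.exp_nat_mul, ← Real.exp_add]
  refine Real.exp_le_exp.2 ?_
  have h2 : t ^ 2 * p ≤ τ := by
    rw [ht2, div_mul_eq_mul_div, div_le_iff₀ hq0]
    exact mul_le_mul_of_nonneg_left (le_max_left _ _) hτ.le
  have h3 := mul_le_mul_of_nonneg_left h2 (Nat.cast_nonneg (α := ℝ) n)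
  have : -t * (n * (2 * √(τ * q))) = -(2 * n * (t * √(τ * q))) := by ring
  rw [this, htq]
  linarith

/-- Bernstein inequality for the empirical mean of a bounded function. -/
lemma measure_pi_abs_mean_sub_gt_le (hf : Measurable f) (h1 : ∀ z, |f z| ≤ 1) {p τ : ℝ}
    (hp : ∫ z, f z ^ 2 ∂ρ ≤ p) (hτ : 0 < τ) {n : ℕ} (hn : 0 < n) :
    (Measure.pi fun _ : Fin n => ρ)
      {D | 2 * √(τ * max p τ) < |1 / (n : ℝ) * ∑ k, f (D k) - ∫ y, f y ∂ρ|} ≤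
        ENNReal.ofReal (2 * Real.exp (-(n * τ))) := by
  have hn' : (0 : ℝ) < n := Nat.cast_pos.2 hn
  have hA := measureReal_pi_sum_ge_le (ρ := ρ) hf h1 hp hτ n
  have hB := measureReal_pi_sum_ge_le (ρ := ρ) (f := fun z => -f z) (p := p) hf.neg
    (by simpa using h1) (by simpa using hp) hτ n
  rw [integral_neg] at hB
  rw [← ofReal_measureReal]
  refine ENNReal.ofReal_le_ofReal ?_
  refine (measureReal_mono ?_).trans ((measureReal_union_le _ _).trans (add_le_add hA hB |>.trans
    (two_mul _).ge))
  intro D hD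
  simp only [Set.mem_ofPred_eq, Set.mem_union] at hD ⊢
  have h2 : 1 / (n : ℝ) * ∑ k, f (D k) - ∫ y, f y ∂ρ =
      (∑ k, (f (D k) - ∫ y, f y ∂ρ)) / n := by
    simp only [Finset.sum_sub_distrib, Finset.sum_const, Finset.card_univ, Fintype.card_fin,
      nsmul_eq_mul]
    field_simp
  have h3 : ∑ k, (-f (D k) - -∫ y, f y ∂ρ) = -∑ k, (f (D k) - ∫ y, f y ∂ρ) := by
    rw [← Finset.sum_neg_distrib]
    exact Finset.sum_congr rfl fun _ _ => by ring
  rw [h2, abs_div, abs_of_pos hn', lt_div_iff₀ hn'] at hD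
  rw [h3]
  rcases le_total 0 (∑ k, (f (D k) - ∫ y, f y ∂ρ)) with h | h
  · left
    rw [abs_of_nonneg h] at hD
    linarith
  · right
    rw [abs_of_nonpos h] at hD
    linarith

end Concentration

/-! ### Finite sums against probability mass functions. -/

section PMFReal

variable {α β : Type*} [Fintype α]

lemma sum_toReal_pmf (p : PMF α) : ∑ a, (p a).toReal = 1 := by
  rw [← ENNReal.toReal_sum fun a _ => p.apply_ne_top a, ← tsum_fintype (L := .unconditional _),
    p.tsum_coe,
    ENNReal.toReal_one]

lemma toReal_bind_apply (p : PMF α) (f : α → PMF β) (b : β) :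
    (p.bind f b).toReal = ∑ a, (p a).toReal * (f a b).toReal := by
  rw [PMF.bind_apply, tsum_fintype, ENNReal.toReal_sum fun a _ =>
    ENNReal.mul_ne_top (p.apply_ne_top a) ((f a).apply_ne_top b)]
  simp

lemma sum_toReal_bind_mul [Fintype β] (p : PMF α) (f : α → PMF β) (g : β → ℝ) :
    ∑ b, (p.bind f b).toReal * g b = ∑ a, (p a).toReal * ∑ b, (f a b).toReal * g b := by
  simp_rw [toReal_bind_apply, Finset.sum_mul, Finset.mul_sum]
  rw [Finset.sum_comm]
  exact Finset.sum_congr rfl fun _ _ => Finset.sum_congr rfl fun _ _ => by ring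

lemma sum_toReal_map_mul [Fintype β] (p : PMF α) (f : α → β) (g : β → ℝ) :
    ∑ b, (p.map f b).toReal * g b = ∑ a, (p a).toReal * g (f a) := by
  classical
  rw [← PMF.bind_pure_comp, sum_toReal_bind_mul]
  refine Finset.sum_congr rfl fun a _ => ?_
  simp [PMF.pure_apply, apply_ite ENNReal.toReal]

lemma sum_pmf_mul_mem_Icc (p : PMF α) {f : α → ℝ} {V : ℝ} (hf : ∀ a, f a ∈ Set.Icc 0 V) :
    ∑ a, (p a).toReal * f a ∈ Set.Icc 0 V := by
  refine ⟨Finset.sum_nonneg fun a _ => mul_nonneg ENNReal.toReal_nonneg (hf a).1, ?_⟩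
  calc ∑ a, (p a).toReal * f a ≤ ∑ a, (p a).toReal * V :=
        Finset.sum_le_sum fun a _ => mul_le_mul_of_nonneg_left (hf a).2 ENNReal.toReal_nonneg
    _ = V := by rw [← Finset.sum_mul, sum_toReal_pmf, one_mul]

end PMFReal

/-! ### The Bellman equation, coverage, and the law of the data. -/

namespace FiniteMDP

variable {S A : Type*} (M : FiniteMDP S A) (π : S → PMF A)

/-- The law of the next state-action pair. -/
noncomputable def step (x : S × A) : PMF (S × A) :=
  (M.P x.1 x.2).bind fun s' => (π s').map fun a' => (s', a')

/-- `law` appends transitions at the end of the trajectory, whereas the Bellman equation splits off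
the first one. -/
lemma law_succ_eq_step_bind (x : S × A) (t : ℕ) :
    M.law π x (t + 1) = (M.step π x).bind fun y => M.law π y t := by
  induction t with
  | zero =>
    simp only [law, PMF.pure_bind, PMF.bind_pure]
    rfl
  | succ t ih =>
    rw [law, ih, PMF.bind_bind]
    rfl

variable [Fintype S] [Fintype A]

lemma sum_step_mul (x : S × A) (f : S × A → ℝ) :
    ∑ y, (M.step π x y).toReal * f y =
      ∑ s', (M.P x.1 x.2 s').toReal * policyValue π f s' := by
  rw [step, sum_toReal_bind_mul]
  refine Finset.sum_congr rfl fun s' _ => ?_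
  rw [sum_toReal_map_mul, policyValue]

lemma toReal_step_apply (x y : S × A) :
    (M.step π x y).toReal = (M.P x.1 x.2 y.1).toReal * (π y.1 y.2).toReal := by
  classical
  have h := M.sum_step_mul π x (Pi.single y 1)
  simp only [Pi.single_apply, mul_ite, mul_one, mul_zero, Finset.sum_ite_eq',
    Finset.mem_univ, if_true] at h
  rw [h, Finset.sum_eq_single y.1]
  · congr 1
    rw [policyValue, Finset.sum_eq_single y.2]
    · simp
    · intro a _ ha
      simp [Prod.ext_iff, ha]
    · simp
  · intro s _ hs
    simp [policyValue, Prod.ext_iff, hs]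
  · simp

omit [Fintype S] in
lemma policyValue_mem_Icc {f : S × A → ℝ} {V : ℝ} (hf : ∀ x, f x ∈ Set.Icc 0 V) (s : S) :
    policyValue π f s ∈ Set.Icc 0 V :=
  sum_pmf_mul_mem_Icc _ fun a => hf (s, a)

/-- The Bellman operator of the policy `π`. -/
noncomputable def bellman (q : S × A → ℝ) (x : S × A) : ℝ :=
  M.R x.1 x.2 + M.γ * ∑ y, (M.step π x y).toReal * q y

lemma bellman_sub (q q' : S × A → ℝ) :
    M.bellman π q - M.bellman π q' =
      fun x => M.γ * ∑ y, (M.step π x y).toReal * (q - q') y := by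
  ext x
  simp only [bellman, Pi.sub_apply, mul_sub, Finset.sum_sub_distrib]
  ring

/-- The expected reward at time `t`. -/
noncomputable def expReward (t : ℕ) (x : S × A) : ℝ :=
  ∑ y, (M.law π x t y).toReal * M.R y.1 y.2

lemma expReward_zero (x : S × A) : M.expReward π 0 x = M.R x.1 x.2 := by
  classical
  simp [expReward, law, PMF.pure_apply, apply_ite ENNReal.toReal]

lemma expReward_succ (t : ℕ) (x : S × A) :
    M.expReward π (t + 1) x = ∑ y, (M.step π x y).toReal * M.expReward π t y := by
  rw [expReward, law_succ_eq_step_bind, sum_toReal_bind_mul]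
  rfl

lemma expReward_mem_Icc (t : ℕ) (x : S × A) : M.expReward π t x ∈ Set.Icc 0 M.Rmax :=
  sum_pmf_mul_mem_Icc _ fun _ => ⟨M.R_nonneg _ _, M.R_le _ _⟩

lemma summable_pow_mul_expReward (x : S × A) :
    Summable fun t => M.γ ^ t * M.expReward π t x :=
  Summable.of_nonneg_of_le
    (fun t => mul_nonneg (pow_nonneg M.γ_nonneg t) (M.expReward_mem_Icc π t x).1)
    (fun t => mul_le_mul_of_nonneg_left (M.expReward_mem_Icc π t x).2
      (pow_nonneg M.γ_nonneg t))
    ((summable_geometric_of_lt_one M.γ_nonneg M.γ_lt_one).mul_right M.Rmax)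

lemma qPi_mem_Icc (x : S × A) : M.qPi π x ∈ Set.Icc 0 M.Vmax := by
  refine ⟨tsum_nonneg fun t => mul_nonneg (pow_nonneg M.γ_nonneg t)
    (M.expReward_mem_Icc π t x).1, ?_⟩
  have hg := summable_geometric_of_lt_one M.γ_nonneg M.γ_lt_one
  calc M.qPi π x ≤ ∑' t, M.γ ^ t * M.Rmax :=
        (M.summable_pow_mul_expReward π x).tsum_le_tsum (fun t =>
          mul_le_mul_of_nonneg_left (M.expReward_mem_Icc π t x).2 (pow_nonneg M.γ_nonneg t))
          (hg.mul_right _)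
    _ = M.Vmax := by
        rw [tsum_mul_right, tsum_geometric_of_lt_one M.γ_nonneg M.γ_lt_one, Vmax]
        ring

lemma bellman_qPi : M.bellman π (M.qPi π) = M.qPi π := by
  ext x
  have h : M.qPi π x = ∑' t, M.γ ^ t * M.expReward π t x := rfl
  rw [h, (M.summable_pow_mul_expReward π x).tsum_eq_zero_add, pow_zero, one_mul,
    expReward_zero, bellman]
  congr 1
  have h2 : ∀ t, M.γ ^ (t + 1) * M.expReward π (t + 1) x =
      M.γ * ∑ y, (M.step π x y).toReal * (M.γ ^ t * M.expReward π t y) := fun t => by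
    rw [expReward_succ, Finset.mul_sum, Finset.mul_sum]
    exact Finset.sum_congr rfl fun _ _ => by ring
  simp_rw [h2]
  rw [tsum_mul_left, Summable.tsum_finsetSum fun y _ =>
    (M.summable_pow_mul_expReward π y).mul_left _]
  simp_rw [tsum_mul_left]
  rfl

variable {M} in
omit [Fintype S] [Fintype A] in
lemma Coverage.one_le {μ : PMF (S × A)} {C : ℝ} (h : M.Coverage μ C) : 1 ≤ C := by
  obtain ⟨-, CS, CA, hA, hS, rfl, -⟩ := h
  exact one_le_mul_of_one_le_of_one_le hS hA

variable {M} in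
omit [Fintype S] [Fintype A] in
lemma Coverage.toReal_pos {μ : PMF (S × A)} {C : ℝ} (h : M.Coverage μ C) (x : S × A) :
    0 < (μ x).toReal :=
  ENNReal.toReal_pos (h.1 x.1 x.2).ne' (μ.apply_ne_top x)

-- Multiply `P(s'|s,a) ≤ C_S μ(s')` by `π(a'|s') ≤ 1 ≤ C_A μ(a'|s')`. This is the only way in which
-- the constant of the coverage condition enters the kernel argument.
variable {M} in
lemma Coverage.toReal_step_le {μ : PMF (S × A)} {C : ℝ} (h : M.Coverage μ C) (x y : S × A) :
    (M.step π x y).toReal ≤ C * (μ y).toReal := by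
  obtain ⟨-, CS, CA, hA, hS, rfl, h1, h2, -⟩ := h
  have hA0 : 0 < CA := one_pos.trans_le hA
  have hS0 : 0 < CS := one_pos.trans_le hS
  set m := (μ.map Prod.fst y.1).toReal with hm
  have h1 := h1 y.1 y.2
  rw [← hm] at h1
  -- With a zero marginal the quotient in the coverage condition would be `0` by convention, below
  -- `1 / CA`.
  have hm0 : 0 < m := by
    refine lt_of_le_of_ne ENNReal.toReal_nonneg fun h0 => ?_
    rw [← h0, div_zero] at h1
    exact absurd h1 (not_le.2 (by positivity))
  have h2 := h2 x.1 x.2 y.1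
  rw [← hm, div_le_iff₀ hm0] at h2
  rw [div_le_div_iff₀ hA0 hm0, one_mul] at h1
  rw [toReal_step_apply]
  have hπ : (π y.1 y.2).toReal ≤ 1 := by
    simpa using ENNReal.toReal_mono ENNReal.one_ne_top ((π y.1).coe_le_one y.2)
  calc (M.P x.1 x.2 y.1).toReal * (π y.1 y.2).toReal ≤ CS * m * 1 :=
        mul_le_mul h2 hπ ENNReal.toReal_nonneg (by positivity)
    _ ≤ CS * ((μ y).toReal * CA) := by
        rw [mul_one]; exact mul_le_mul_of_nonneg_left h1 hS0.le
    _ = _ := by ring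

section Sampling

variable [MeasurableSpace S] [MeasurableSingletonClass S] [MeasurableSpace A]
  [MeasurableSingletonClass A] (μ : PMF (S × A))

instance : IsProbabilityMeasure (M.sampleLaw μ).toMeasure := PMF.toMeasure.isProbabilityMeasure _

/-- The reward coordinate is real, so the sample space is not finite. Viewing the law as a
push-forward from a finite space turns integrals into finite sums and makes the reward almost surely
a function of the pair. -/
lemma toMeasure_sampleLaw :
    (M.sampleLaw μ).toMeasure =
      (μ.bind fun x => (M.P x.1 x.2).map fun s' => (x, s')).toMeasure.map
        fun z : (S × A) × S => (z.1.1, z.1.2, M.R z.1.1 z.1.2, z.2) := by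
  have hg : Measurable fun z : (S × A) × S => (z.1.1, z.1.2, M.R z.1.1 z.1.2, z.2) :=
    measurable_of_finite _
  rw [PMF.toMeasure_map _ _ hg, PMF.map_bind]
  simp only [PMF.map_comp]
  rfl

omit [Fintype S] [Fintype A] in
lemma measurable_sample [Finite S] [Finite A] (f : S × A → S → ℝ) :
    Measurable fun z : S × A × ℝ × S => f (z.1, z.2.1) z.2.2.2 := by
  have : Measurable fun z : (S × A) × S => f z.1 z.2 := measurable_of_finite _
  exact this.comp (g := fun z => f z.1 z.2)
    (f := fun z : S × A × ℝ × S => ((z.1, z.2.1), z.2.2.2)) (by fun_prop)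

lemma integral_sampleLaw (f : S × A → S → ℝ) :
    ∫ z, f (z.1, z.2.1) z.2.2.2 ∂(M.sampleLaw μ).toMeasure =
      ∑ x, (μ x).toReal * ∑ s', (M.P x.1 x.2 s').toReal * f x s' := by
  rw [toMeasure_sampleLaw, integral_map (measurable_of_finite _).aemeasurable
    (measurable_sample f).aestronglyMeasurable, PMF.integral_eq_sum]
  simp only [smul_eq_mul]
  rw [sum_toReal_bind_mul]
  refine Finset.sum_congr rfl fun x _ => ?_
  rw [sum_toReal_map_mul]

lemma ae_sampleLaw_reward :
    ∀ᵐ z ∂(M.sampleLaw μ).toMeasure, z.2.2.1 = M.R z.1 z.2.1 := by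
  have hR : Measurable fun z : S × A => M.R z.1 z.2 := measurable_of_finite _
  have hR' : Measurable fun z : S × A × ℝ × S => M.R z.1 z.2.1 :=
    hR.comp (f := fun z : S × A × ℝ × S => (z.1, z.2.1)) (by fun_prop)
  rw [toMeasure_sampleLaw, ae_map_iff (measurable_of_finite _).aemeasurable
    (measurableSet_eq_fun (by fun_prop) hR')]
  exact ae_of_all _ fun _ => rfl

lemma ae_dataLaw_reward (n : ℕ) :
    ∀ᵐ D ∂M.dataLaw μ n, ∀ k, (D k).2.2.1 = M.R (D k).1 (D k).2.1 := by
  rw [ae_all_iff]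
  intro k
  exact (Measure.quasiMeasurePreserving_eval
    (fun _ : Fin n => (M.sampleLaw μ).toMeasure) k).ae (M.ae_sampleLaw_reward μ)

end Sampling

end FiniteMDP

/-! ### Comparing empirical and population projections cell by cell. -/

section CellDeviation

/-- Comparison of a normalized cell sum with its empirical counterpart when both the sums `w`, `w'`
and the masses `p`, `p'` are close. -/
lemma abs_div_sqrt_le {p p' w w' V τ : ℝ} (hp : 0 ≤ p) (hp' : 0 ≤ p') (hV : 0 ≤ V) (hτ : 0 < τ)
    (hw : |w| ≤ V * p) (hw' : |w'| ≤ V * p') (hpp : |p' - p| ≤ 2 * √(τ * max p τ))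
    (hww : |w' - w| ≤ V * (2 * √(τ * max p τ))) :
    |w / √p| ≤ √2 * |w' / √p'| + 5 * V * √τ ∧ |w' / √p'| ≤ √2 * |w / √p| + 5 * V * √τ := by
  have crude : ∀ {p w : ℝ}, 0 ≤ p → |w| ≤ V * p → p ≤ 25 * τ → |w / √p| ≤ 5 * V * √τ := by
    intro p w hp hw hpτ
    rw [abs_div, abs_of_nonneg (Real.sqrt_nonneg p)]
    refine div_le_of_le_mul₀ (Real.sqrt_nonneg _) (by positivity) (hw.trans ?_)
    have h1 : √p ≤ 5 * √τ := by
      rw [Real.sqrt_le_left (by positivity), mul_pow, Real.sq_sqrt hτ.le]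
      linarith
    calc V * p = V * √p * √p := by rw [mul_assoc, Real.mul_self_sqrt hp]
      _ ≤ V * (5 * √τ) * √p := by gcongr
      _ = _ := by ring
  -- For `p < 16τ` the deviation is at most `8τ`, so both masses are below `25τ` and each side is at
  -- most the additive term `5V√τ`. For `p ≥ 16τ` the deviation is at most `p / 2`, so the masses
  -- agree up to a factor `2`, whence `√2`.
  rcases lt_or_ge p (16 * τ) with h | h
  · have hmax : √(τ * max p τ) ≤ 4 * τ := by
      rw [Real.sqrt_le_left (by positivity)]
      have : max p τ ≤ 16 * τ := max_le h.le (by linarith)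
      nlinarith
    have h' : p' ≤ 25 * τ := by linarith [(abs_le.1 hpp).2]
    have h1 := crude hp hw (by linarith)
    have h2 := crude hp' hw' h'
    have h3 : 0 ≤ √2 * |w' / √p'| := by positivity
    have h4 : 0 ≤ √2 * |w / √p| := by positivity
    constructor <;> linarith
  · have hp0 : 0 < p := by linarith
    rw [max_eq_left (by linarith), Real.sqrt_mul hτ.le] at hpp hww
    have hP0 : 0 < √p := Real.sqrt_pos.2 hp0
    have hT : √τ ≤ √p / 4 := by
      rw [Real.sqrt_le_left (by positivity), div_pow, Real.sq_sqrt hp]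
      linarith
    have hTP : √τ * √p ≤ p / 4 := by
      calc √τ * √p ≤ √p / 4 * √p := by gcongr
        _ = p / 4 := by rw [div_mul_eq_mul_div, Real.mul_self_sqrt hp]
    obtain ⟨hl, hu⟩ := abs_le.1 hpp
    have hp'0 : 0 < p' := by linarith
    have hP'0 : 0 < √p' := Real.sqrt_pos.2 hp'0
    have hPP' : √p ≤ √2 * √p' := by
      rw [← Real.sqrt_mul zero_le_two]
      exact Real.sqrt_le_sqrt (by linarith)
    have hP'P : √p' ≤ √2 * √p := by
      rw [← Real.sqrt_mul zero_le_two]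
      exact Real.sqrt_le_sqrt (by linarith)
    have h2 : √2 ≤ 3 / 2 := by
      rw [Real.sqrt_le_left (by norm_num)]
      norm_num
    have hww2 : |w| ≤ |w'| + V * (2 * (√τ * √p)) := by
      have := abs_sub_abs_le_abs_sub w w'
      rw [abs_sub_comm] at this
      linarith
    have hww1 : |w'| ≤ |w| + V * (2 * (√τ * √p)) := by
      have := abs_sub_abs_le_abs_sub w' w
      linarith
    have hVT : 0 ≤ V * √τ := by positivity
    rw [abs_div, abs_div, abs_of_pos hP0, abs_of_pos hP'0]
    constructor
    · rw [div_le_iff₀ hP0]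
      have e1 : |w'| ≤ √2 * (|w'| / √p') * √p := by
        calc |w'| = |w'| / √p' * √p' := by field_simp
          _ ≤ |w'| / √p' * (√2 * √p) := by gcongr
          _ = _ := by ring
      have e2 : 0 ≤ V * √τ * √p := by positivity
      nlinarith
    · have e1 : |w'| / √p' ≤ √2 * (|w'| / √p) := by
        rw [div_le_iff₀ hP'0]
        calc |w'| = |w'| / √p * √p := by field_simp
          _ ≤ |w'| / √p * (√2 * √p') := by gcongr
          _ = _ := by ring
      have e2 : |w'| / √p ≤ |w| / √p + 2 * (V * √τ) := by
        rw [div_le_iff₀ hP0]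
        refine hww1.trans (le_of_eq ?_)
        field_simp
      have e3 : √2 * (|w'| / √p) ≤ √2 * (|w| / √p + 2 * (V * √τ)) := by gcongr
      nlinarith

variable {ι ι' Y : Type*} [Fintype ι] [Fintype ι'] [Fintype Y] [DecidableEq Y]
  {w : ι → ℝ} {w' : ι' → ℝ} {ψ : ι → Y} {ψ' : ι' → Y} {f : ι → ℝ} {f' : ι' → ℝ}

/-- Two projections to cell-constant functions, over different index types, have comparable norms
if the masses and the weighted sums of all cells are close. -/
lemma wnorm_cellAvg_compare (hw : ∀ i, 0 ≤ w i) (hw' : ∀ i, 0 ≤ w' i) {V τ : ℝ} (hV : 0 ≤ V)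
    (hτ : 0 < τ) (hf : ∀ i, |f i| ≤ V) (hf' : ∀ i, |f' i| ≤ V)
    (hm : ∀ c, |cellMass w' ψ' c - cellMass w ψ c| ≤ 2 * √(τ * max (cellMass w ψ c) τ))
    (hs : ∀ c, |cellSum w' ψ' f' c - cellSum w ψ f c| ≤
      V * (2 * √(τ * max (cellMass w ψ c) τ))) :
    wnorm w (cellAvg w ψ f) ≤
        √2 * wnorm w' (cellAvg w' ψ' f') + 5 * V * √τ * √(Fintype.card Y) ∧
      wnorm w' (cellAvg w' ψ' f') ≤
        √2 * wnorm w (cellAvg w ψ f) + 5 * V * √τ * √(Fintype.card Y) := by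
  have key : ∀ c, _ := fun c => abs_div_sqrt_le (cellMass_nonneg hw c) (cellMass_nonneg hw' c) hV hτ
    (abs_cellSum_le (ψ := ψ) hw c hf) (abs_cellSum_le (ψ := ψ') hw' c hf') (hm c) (hs c)
  rw [wnorm_cellAvg hw, wnorm_cellAvg hw']
  exact ⟨wnorm_one_le (Real.sqrt_nonneg _) (by positivity) fun c => (key c).1,
    wnorm_one_le (Real.sqrt_nonneg _) (by positivity) fun c => (key c).2⟩

end CellDeviation

/-! ### The empirical least-squares update. -/

section EmpiricalProjection

variable {S A Y : Type*} [Fintype A] [DecidableEq Y] {n : ℕ}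

/-- The state-action pair of a data tuple. -/
def dataPair (D : Fin n → S × A × ℝ × S) (k : Fin n) : S × A := ((D k).1, (D k).2.1)

/-- The regression target of a data tuple. -/
noncomputable def dataTarget (γ : ℝ) (π : S → PMF A) (D : Fin n → S × A × ℝ × S) (q : S × A → ℝ)
    (k : Fin n) : ℝ :=
  (D k).2.2.1 + γ * policyValue π q (D k).2.2.2

/-- The weights of the empirical distribution. -/
noncomputable def unifWeight (n : ℕ) (_ : Fin n) : ℝ := 1 / n

lemma unifWeight_nonneg (n : ℕ) (k : Fin n) : 0 ≤ unifWeight n k := by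
  unfold unifWeight; positivity

lemma unifWeight_pos (hn : 0 < n) (k : Fin n) : 0 < unifWeight n k := by
  unfold unifWeight; positivity

lemma sum_unifWeight (hn : 0 < n) : ∑ k, unifWeight n k = 1 := by
  have : (n : ℝ) ≠ 0 := by positivity
  simp [unifWeight, this]

omit [Fintype A] in
lemma empNorm_eq_wnorm (D : Fin n → S × A × ℝ × S) (f : S × A → ℝ) :
    empNorm D f = wnorm (unifWeight n) (f ∘ dataPair D) := by
  rw [empNorm, wnorm, Finset.mul_sum]
  rfl

lemma empRisk_eq_sum (γ : ℝ) (π : S → PMF A) (D : Fin n → S × A × ℝ × S) (q g : S × A → ℝ) :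
    empRisk γ π D q g =
      ∑ k, unifWeight n k * (g (dataPair D k) - dataTarget γ π D q k) ^ 2 := by
  rw [empRisk, Finset.mul_sum]
  refine Finset.sum_congr rfl fun k _ => ?_
  rw [dataTarget, unifWeight, dataPair, sub_sub]

/-- On the data, the empirical projected Bellman update is the cell average of the targets. -/
lemma IsEmpProjBellman.comp_dataPair {γ V : ℝ} {π : S → PMF A} {D : Fin n → S × A × ℝ × S}
    {φ : S × A → Y} {q g : S × A → ℝ} (hn : 0 < n) (hV : 0 ≤ V)
    (hy : ∀ k, dataTarget γ π D q k ∈ Set.Icc 0 V)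
    (h : IsEmpProjBellman γ π D (piecewiseConst V φ) q g) :
    g ∘ dataPair D = cellAvg (unifWeight n) (φ ∘ dataPair D) (dataTarget γ π D q) := by
  obtain ⟨⟨-, hg⟩, hmin⟩ := h
  have hu := unifWeight_pos hn
  refine eq_cellAvg_of_sum_le hu (fun i j hij => hg _ _ hij) ?_
  -- The unconstrained least-squares fit is a valid competitor: averages of targets stay in `[0,
  -- V]`, and on cells without data the quotient `0 / 0` gives the admissible value `0`.
  let g' : S × A → ℝ := fun x => cellSum (unifWeight n) (φ ∘ dataPair D) (dataTarget γ π D q) (φ x) /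
    cellMass (unifWeight n) (φ ∘ dataPair D) (φ x)
  have hg' : g' ∈ piecewiseConst V φ := by
    refine ⟨fun x => ?_, fun x y hxy => by simp only [g', hxy]⟩
    by_cases hx : ∃ k, φ (dataPair D k) = φ x
    · obtain ⟨k, hk⟩ := hx
      have := cellAvg_mem_Icc (ψ := φ ∘ dataPair D) hu k fun j _ => hy j
      rw [cellAvg] at this
      simp only [g', ← hk]
      exact this
    · push Not at hx
      have : cellSum (unifWeight n) (φ ∘ dataPair D) (dataTarget γ π D q) (φ x) = 0 := by
        rw [cellSum, Finset.filter_false_of_mem (by simpa using hx), Finset.sum_empty]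
      simp only [g', this, zero_div]
      exact ⟨le_rfl, hV⟩
  have := isMinOn_iff.1 hmin g' hg'
  rw [empRisk_eq_sum, empRisk_eq_sum] at this
  exact this

end EmpiricalProjection

/-! ### Error propagation under the population distribution. -/

namespace FiniteMDP

variable {S A : Type*} [Fintype S] [Fintype A] {M : FiniteMDP S A} {μ : PMF (S × A)} {C : ℝ}
  (π : S → PMF A)

/-- A small projected Bellman residual of `q` under the data distribution makes `q` close to `Q^π`
under every covered distribution `w`, if `Q^π` is nearly constant on the cells. -/
lemma Coverage.wnorm_sub_qPi_le {Y : Type*} [DecidableEq Y] (hcov : M.Coverage μ C)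
    (q : S × A → ℝ) (ψ : S × A → Y) {b : ℝ} (hb : 0 ≤ b)
    (hosc : ∀ x y, ψ x = ψ y → |M.qPi π x - M.qPi π y| ≤ b) {w : S × A → ℝ} (hw : ∀ x, 0 ≤ w x)
    (hw1 : ∑ x, w x = 1) (hwC : ∀ x, w x ≤ C * (μ x).toReal) :
    (1 - M.γ) * wnorm w (q - M.qPi π) ≤
      √C * wnorm (fun x => (μ x).toReal)
        (q - cellAvg (fun x => (μ x).toReal) ψ (M.bellman π q)) + b := by
  set m : S × A → ℝ := fun x => (μ x).toReal with hm
  have hm0 : ∀ x, 0 < m x := hcov.toReal_pos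
  set a := √C * wnorm m (q - cellAvg m ψ (M.bellman π q)) + b with ha
  set h := q - M.qPi π with hh
  have hC := hcov.one_le
  -- The kernel `ΠP`: averaging in the starting point keeps rows stochastic and the pointwise bound
  -- `C * m y`.
  let k : S × A → S × A → ℝ := fun x y => cellAvg m ψ (fun z => (M.step π z y).toReal) x
  have hk : ∀ x y, k x y ∈ Set.Icc 0 (C * m y) := fun x y =>
    cellAvg_mem_Icc hm0 x fun z _ => ⟨ENNReal.toReal_nonneg, hcov.toReal_step_le π z y⟩
  have hk1 : ∀ x, ∑ y, k x y = 1 := fun x => by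
    have h1 := cellAvg_sum_mul (w := m) (ψ := ψ) (fun z y => (M.step π z y).toReal) (fun _ => 1) x
    simp only [mul_one, sum_toReal_pmf] at h1
    rw [← h1, cellAvg_comp hm0 fun _ _ _ => rfl]
  have one_step : ∀ w : S × A → ℝ, (∀ x, 0 ≤ w x) → ∑ x, w x = 1 →
      (∀ x, w x ≤ C * m x) →
      wnorm w h ≤ a + M.γ * wnorm (fun y => ∑ x, w x * k x y) h := by
    intro w hw hw1 hwC
    have hdec : h = (q - cellAvg m ψ (M.bellman π q)) +
        ((fun x => M.γ * ∑ y, k x y * h y) + (cellAvg m ψ (M.qPi π) - M.qPi π)) := by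
      have e : (fun x => M.γ * ∑ y, k x y * h y) =
          cellAvg m ψ (M.bellman π q) - cellAvg m ψ (M.bellman π (M.qPi π)) := by
        rw [← cellAvg_sub, bellman_sub, cellAvg_const_mul]
        ext x
        rw [cellAvg_sum_mul]
      rw [e, bellman_qPi, hh]
      abel
    have e1 : wnorm w (q - cellAvg m ψ (M.bellman π q)) ≤
        √C * wnorm m (q - cellAvg m ψ (M.bellman π q)) :=
      wnorm_le_sqrt_mul (by linarith) hwC
    have e2 : wnorm w (fun x => M.γ * ∑ y, k x y * h y) ≤
        M.γ * wnorm (fun y => ∑ x, w x * k x y) h := by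
      rw [wnorm_const_mul, abs_of_nonneg M.γ_nonneg]
      exact mul_le_mul_of_nonneg_left (wnorm_kernel_le hw (fun x y => (hk x y).1) hk1) M.γ_nonneg
    have e3 : wnorm w (cellAvg m ψ (M.qPi π) - M.qPi π) ≤ b :=
      wnorm_le_of_abs_le hw hw1 hb fun x => by
        rw [Pi.sub_apply, abs_sub_comm]
        exact abs_sub_cellAvg_le hm0 x fun y hy => hosc x y hy.symm
    have e4 := wnorm_add_le (f := q - cellAvg m ψ (M.bellman π q))
      (g := (fun x => M.γ * ∑ y, k x y * h y) + (cellAvg m ψ (M.qPi π) - M.qPi π)) hw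
    have e5 := wnorm_add_le (f := fun x => M.γ * ∑ y, k x y * h y)
      (g := cellAvg m ψ (M.qPi π) - M.qPi π) hw
    rw [← hdec] at e4
    linarith
  -- This set is stable under `w ↦ w k`, so a single step bounds the supremum by itself times `γ`,
  -- and no iteration along the trajectory is needed.
  let adm : Set (S × A → ℝ) := {w | (∀ x, 0 ≤ w x) ∧ ∑ x, w x = 1 ∧ ∀ x, w x ≤ C * m x}
  have hbdd : BddAbove ((fun w => wnorm w h) '' adm) := by
    refine ⟨‖h‖, ?_⟩
    rintro _ ⟨w, ⟨h1, h2, -⟩, rfl⟩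
    exact wnorm_le_of_abs_le h1 h2 (norm_nonneg _) fun x => norm_le_pi_norm h x
  have hsup : sSup ((fun w => wnorm w h) '' adm) ≤
      a + M.γ * sSup ((fun w => wnorm w h) '' adm) := by
    refine csSup_le ⟨_, w, ⟨hw, hw1, hwC⟩, rfl⟩ ?_
    rintro _ ⟨w, ⟨h1, h2, h3⟩, rfl⟩
    refine (one_step w h1 h2 h3).trans (add_le_add_right
      (mul_le_mul_of_nonneg_left (le_csSup hbdd ⟨_, ⟨?_, ?_, ?_⟩, rfl⟩) M.γ_nonneg) _)
    · exact fun y => Finset.sum_nonneg fun x _ => mul_nonneg (h1 x) (hk x y).1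
    · rw [Finset.sum_comm]
      simp only [← Finset.mul_sum, hk1, mul_one, h2]
    · intro y
      calc ∑ x, w x * k x y ≤ ∑ x, w x * (C * m y) :=
            Finset.sum_le_sum fun x _ => mul_le_mul_of_nonneg_left (hk x y).2 (h1 x)
        _ = C * m y := by rw [← Finset.sum_mul, h2, one_mul]
  have hle : wnorm w h ≤ sSup ((fun w => wnorm w h) '' adm) :=
    le_csSup hbdd ⟨w, ⟨hw, hw1, hwC⟩, rfl⟩
  have := mul_le_mul_of_nonneg_left hle (sub_nonneg.2 M.γ_lt_one.le)
  linarith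

/-- Since `Q^π` is a fixed point, the residual is `(q - Q^π) - (Tq - TQ^π)`, and `T` is nonexpansive
in the sup norm. -/
lemma wnorm_sub_bellman_le (q : S × A → ℝ) :
    wnorm (fun x => (μ x).toReal) (q - M.bellman π q) ≤ 2 * ‖q - M.qPi π‖ := by
  refine wnorm_le_of_abs_le (fun _ => ENNReal.toReal_nonneg) (sum_toReal_pmf μ) (by positivity)
    fun x => ?_
  have h1 : |(q - M.qPi π) x| ≤ ‖q - M.qPi π‖ := norm_le_pi_norm (q - M.qPi π) x
  have h2 : |(M.bellman π q - M.bellman π (M.qPi π)) x| ≤ ‖q - M.qPi π‖ := by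
    rw [bellman_sub, abs_mul, abs_of_nonneg M.γ_nonneg]
    refine (mul_le_of_le_one_left (abs_nonneg _) M.γ_lt_one.le).trans
      ((Finset.abs_sum_le_sum_abs _ _).trans ?_)
    calc ∑ y, |(M.step π x y).toReal * (q - M.qPi π) y|
        ≤ ∑ y, (M.step π x y).toReal * ‖q - M.qPi π‖ := by
          refine Finset.sum_le_sum fun y _ => ?_
          rw [abs_mul, abs_of_nonneg ENNReal.toReal_nonneg]
          exact mul_le_mul_of_nonneg_left (norm_le_pi_norm (q - M.qPi π) y)
            ENNReal.toReal_nonneg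
      _ = _ := by rw [← Finset.sum_mul, sum_toReal_pmf, one_mul]
  rw [bellman_qPi] at h2
  have : (q - M.bellman π q) x = (q - M.qPi π) x - (M.bellman π q - M.qPi π) x := by
    simp only [Pi.sub_apply]; ring
  rw [this]
  exact (abs_sub _ _).trans (by linarith)

end FiniteMDP

/-! ### All cells are accurate with high probability. -/

namespace FiniteMDP

variable {S A Y : Type*} [Fintype S] [Fintype A] {M : FiniteMDP S A} {μ : PMF (S × A)}
  (π : S → PMF A)

omit [Fintype S] [Fintype A] in
lemma Rmax_nonneg (μ : PMF (S × A)) : 0 ≤ M.Rmax := by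
  obtain ⟨x, -⟩ := μ.support_nonempty
  exact (M.R_nonneg x.1 x.2).trans (M.R_le _ _)

omit [Fintype S] [Fintype A] in
lemma Rmax_add_mul_Vmax : M.Rmax + M.γ * M.Vmax = M.Vmax := by
  have := sub_pos.2 M.γ_lt_one
  rw [Vmax]
  field_simp
  ring

omit [Fintype S] in
lemma target_mem_Icc {q : S × A → ℝ} (hq : ∀ x, q x ∈ Set.Icc 0 M.Vmax) (x : S × A) (s' : S) :
    M.R x.1 x.2 + M.γ * policyValue π q s' ∈ Set.Icc 0 M.Vmax := by
  have h := policyValue_mem_Icc π hq s'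
  have h1 := mul_nonneg M.γ_nonneg h.1
  have h2 := mul_le_mul_of_nonneg_left h.2 M.γ_nonneg
  constructor
  · linarith [M.R_nonneg x.1 x.2]
  · linarith [M.R_le x.1 x.2, M.Rmax_add_mul_Vmax]

lemma bellman_eq_sum (q : S × A → ℝ) (x : S × A) :
    M.bellman π q x =
      ∑ s', (M.P x.1 x.2 s').toReal * (M.R x.1 x.2 + M.γ * policyValue π q s') := by
  simp only [mul_add, Finset.sum_add_distrib]
  rw [← Finset.sum_mul, sum_toReal_pmf, one_mul, bellman, sum_step_mul, Finset.mul_sum]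
  congr 1
  exact Finset.sum_congr rfl fun _ _ => by ring

lemma bellman_mem_Icc {q : S × A → ℝ} (hq : ∀ x, q x ∈ Set.Icc 0 M.Vmax) (x : S × A) :
    M.bellman π q x ∈ Set.Icc 0 M.Vmax := by
  rw [bellman_eq_sum]
  exact sum_pmf_mul_mem_Icc _ fun s' => target_mem_Icc π hq x s'

variable [DecidableEq Y] {n : ℕ}

/-- The empirical mass of the cell `c` and the empirical sum of the Bellman residuals of `q` over
the cell `c` are close to their expectations. -/
def IsCellAccurate (M : FiniteMDP S A) (μ : PMF (S × A)) (π : S → PMF A) (τ : ℝ)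
    (D : Fin n → S × A × ℝ × S) (φ : S × A → Y) (q : S × A → ℝ) (c : Y) : Prop :=
  |cellMass (unifWeight n) (φ ∘ dataPair D) c - cellMass (fun x => (μ x).toReal) φ c| ≤
      2 * √(τ * max (cellMass (fun x => (μ x).toReal) φ c) τ) ∧
  |cellSum (unifWeight n) (φ ∘ dataPair D) (q ∘ dataPair D - dataTarget M.γ π D q) c -
      cellSum (fun x => (μ x).toReal) φ (q - M.bellman π q) c| ≤
    M.Vmax * (2 * √(τ * max (cellMass (fun x => (μ x).toReal) φ c) τ))

section Probability

variable [MeasurableSpace S] [MeasurableSingletonClass S] [MeasurableSpace A]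
  [MeasurableSingletonClass A]

instance : IsProbabilityMeasure (M.dataLaw μ n) := by
  unfold dataLaw; infer_instance

/-- A function bounded by `1` and supported on a cell has second moment at most the mass of the
cell, which therefore serves as variance proxy; light cells get proportionally smaller deviations.
-/
lemma measure_abs_mean_sub_gt_le (f : S × A → S → ℝ) (φ : S × A → Y) (c : Y)
    (hf : ∀ x s', |f x s'| ≤ 1) (hfc : ∀ x s', φ x ≠ c → f x s' = 0) {τ : ℝ} (hτ : 0 < τ)
    (hn : 0 < n) :
    M.dataLaw μ n {D | 2 * √(τ * max (cellMass (fun x => (μ x).toReal) φ c) τ) <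
        |1 / (n : ℝ) * ∑ k, f (dataPair D k) (D k).2.2.2 -
          ∑ x, (μ x).toReal * ∑ s', (M.P x.1 x.2 s').toReal * f x s'|} ≤
      ENNReal.ofReal (2 * Real.exp (-(n * τ))) := by
  rw [← integral_sampleLaw]
  refine measure_pi_abs_mean_sub_gt_le (f := fun z : S × A × ℝ × S => f (z.1, z.2.1) z.2.2.2)
    (measurable_sample f) (fun z => hf _ _) ?_ hτ hn
  rw [M.integral_sampleLaw μ fun x s' => f x s' ^ 2, cellMass, Finset.sum_filter]
  refine Finset.sum_le_sum fun x _ => ?_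
  split_ifs with hx
  · refine mul_le_of_le_one_right ENNReal.toReal_nonneg ?_
    exact (sum_pmf_mul_mem_Icc _ fun s' =>
      ⟨sq_nonneg _, (sq_le_one_iff_abs_le_one _).2 (hf x s')⟩).2
  · simp [hfc x _ hx]

lemma measure_not_isCellAccurate_le {q : S × A → ℝ} (hV : 0 < M.Vmax)
    (hq : ∀ x, q x ∈ Set.Icc 0 M.Vmax) (φ : S × A → Y) (c : Y) {τ : ℝ} (hτ : 0 < τ)
    (hn : 0 < n) :
    M.dataLaw μ n {D | ¬ M.IsCellAccurate μ π τ D φ q c} ≤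
      ENNReal.ofReal (4 * Real.exp (-(n * τ))) := by
  let f₁ : S × A → S → ℝ := fun x _ => if φ x = c then 1 else 0
  -- Dividing by `M.Vmax` brings the residual into `[-1, 1]`. The true reward replaces the recorded
  -- one, at the cost of a null set, so that only finitely valued coordinates occur.
  let f₂ : S × A → S → ℝ := fun x s' =>
    if φ x = c then (q x - (M.R x.1 x.2 + M.γ * policyValue π q s')) / M.Vmax else 0
  let E : (S × A → S → ℝ) → Set (Fin n → S × A × ℝ × S) := fun f =>
    {D | 2 * √(τ * max (cellMass (fun x => (μ x).toReal) φ c) τ) <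
      |1 / (n : ℝ) * ∑ k, f (dataPair D k) (D k).2.2.2 -
        ∑ x, (μ x).toReal * ∑ s', (M.P x.1 x.2 s').toReal * f x s'|}
  have h₁ : M.dataLaw μ n (E f₁) ≤ _ := measure_abs_mean_sub_gt_le (M := M) (μ := μ) (n := n) f₁ φ c
    (fun x _ => by by_cases h : φ x = c <;> simp [f₁, h]) (fun x _ hx => by simp [f₁, hx]) hτ hn
  have h₂ : M.dataLaw μ n (E f₂) ≤ _ := measure_abs_mean_sub_gt_le (M := M) (μ := μ) (n := n) f₂ φ c
    (fun x s' => by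
      by_cases h : φ x = c
      · have ht := target_mem_Icc (M := M) π hq x s'
        have hx := hq x
        simp only [f₂, h, if_true]
        rw [abs_div, abs_of_pos hV, div_le_one hV, abs_le]
        constructor <;> linarith [ht.1, ht.2, hx.1, hx.2]
      · simp [f₂, h]) (fun x _ hx => by simp [f₂, hx]) hτ hn
  have hsub : {D | ¬ M.IsCellAccurate μ π τ D φ q c} ⊆
      ({D : Fin n → S × A × ℝ × S | ¬ ∀ k, (D k).2.2.1 = M.R (D k).1 (D k).2.1} ∪ E f₁) ∪ E f₂ := by
    intro D hD
    by_contra hcon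
    simp only [Set.mem_union, not_or] at hcon
    obtain ⟨⟨hr, hA⟩, hB⟩ := hcon
    replace hr : ∀ k, (D k).2.2.1 = M.R (D k).1 (D k).2.1 := not_not.1 hr
    refine hD ⟨?_, ?_⟩
    · refine (le_of_eq ?_).trans (not_lt.1 (show ¬ _ < _ from hA))
      congr 2
      · rw [cellMass, Finset.sum_filter, Finset.mul_sum]
        exact Finset.sum_congr rfl fun k _ => by simp [f₁, unifWeight]
      · rw [cellMass, Finset.sum_filter]
        refine Finset.sum_congr rfl fun x _ => ?_
        rw [← Finset.sum_mul, sum_toReal_pmf]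
        simp
    · have hB' := mul_le_mul_of_nonneg_left (not_lt.1 (show ¬ _ < _ from hB)) hV.le
      refine (le_of_eq ?_).trans hB'
      rw [← abs_of_pos hV, ← abs_mul, mul_sub]
      congr 2
      · rw [cellSum, Finset.sum_filter, Finset.mul_sum, Finset.mul_sum]
        refine Finset.sum_congr rfl fun k _ => ?_
        by_cases h : φ (dataPair D k) = c
        · simp only [Function.comp_apply, h, if_true, f₂, unifWeight, Pi.sub_apply, dataTarget,
            hr k]
          field_simp
          rfl
        · simp [h, f₂]
      · rw [cellSum, Finset.sum_filter, Finset.mul_sum]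
        refine Finset.sum_congr rfl fun x _ => ?_
        by_cases h : φ x = c
        · simp only [h, if_true, f₂, mul_div_assoc', ← Finset.sum_div, Pi.sub_apply]
          rw [bellman_eq_sum]
          simp only [mul_sub, Finset.sum_sub_distrib]
          rw [← Finset.sum_mul, sum_toReal_pmf]
          field_simp
        · simp [h, f₂]
  refine (measure_mono hsub).trans ((measure_union_le _ _).trans ?_)
  refine (add_le_add (measure_union_le _ _) h₂).trans ?_
  have h₀ : M.dataLaw μ n {D | ¬ ∀ k, (D k).2.2.1 = M.R (D k).1 (D k).2.1} = 0 :=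
    ae_iff.1 (M.ae_dataLaw_reward μ n)
  rw [h₀, zero_add]
  refine (add_le_add_left h₁ _).trans ?_
  rw [← ENNReal.ofReal_add (by positivity) (by positivity)]
  exact ENNReal.ofReal_le_ofReal (by linarith)

/-- With high probability all cells of all partitions are accurate and the rewards are correct. -/
lemma le_measure_forall_isCellAccurate {ι : Type*} [Fintype ι] [Fintype Y] (hV : 0 < M.Vmax)
    {q : ι → S × A → ℝ} (hq : ∀ i x, q i x ∈ Set.Icc 0 M.Vmax) (φ : ι → S × A → Y) {τ : ℝ}
    (hτ : 0 < τ) (hn : 0 < n) {δ : ℝ} (hδ : 0 ≤ δ)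
    (hcard : Fintype.card ι * Fintype.card Y * (4 * Real.exp (-(n * τ))) ≤ δ) :
    ENNReal.ofReal (1 - δ) ≤ M.dataLaw μ n
      {D | (∀ k, (D k).2.2.1 = M.R (D k).1 (D k).2.1) ∧
        ∀ i c, M.IsCellAccurate μ π τ D (φ i) (q i) c} := by
  set G := {D : Fin n → S × A × ℝ × S | (∀ k, (D k).2.2.1 = M.R (D k).1 (D k).2.1) ∧
        ∀ i c, M.IsCellAccurate μ π τ D (φ i) (q i) c} with hG
  set B := ⋃ ic : ι × Y, {D | ¬ M.IsCellAccurate (n := n) μ π τ D (φ ic.1) (q ic.1) ic.2} with hB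
  set N := {D : Fin n → S × A × ℝ × S | ¬ ∀ k, (D k).2.2.1 = M.R (D k).1 (D k).2.1} with hN
  have h₀ : M.dataLaw μ n N = 0 := ae_iff.1 (M.ae_dataLaw_reward μ n)
  have hBle : M.dataLaw μ n B ≤ ENNReal.ofReal δ := by
    refine (measure_iUnion_fintype_le _ _).trans ((Finset.sum_le_sum fun ic _ =>
      measure_not_isCellAccurate_le π hV (hq ic.1) (φ ic.1) ic.2 hτ hn).trans ?_)
    rw [Finset.sum_const, Finset.card_univ, nsmul_eq_mul, Fintype.card_prod,
      ← ENNReal.ofReal_natCast, ← ENNReal.ofReal_mul (Nat.cast_nonneg _)]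
    refine ENNReal.ofReal_le_ofReal ?_
    push_cast
    exact hcard
  have huniv : Set.univ ⊆ G ∪ (B ∪ N) := by
    intro D _
    by_contra hcon
    simp only [Set.mem_union, not_or, hB, hN, hG, Set.mem_iUnion, Set.mem_ofPred_eq, not_not,
      not_exists, Prod.forall] at hcon
    exact hcon.1 ⟨hcon.2.2, hcon.2.1⟩
  have h1 : (1 : ENNReal) ≤ M.dataLaw μ n G + ENNReal.ofReal δ := by
    calc (1 : ENNReal) = M.dataLaw μ n Set.univ := measure_univ.symm
      _ ≤ M.dataLaw μ n G + (M.dataLaw μ n B + M.dataLaw μ n N) :=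
        (measure_mono huniv).trans ((measure_union_le _ _).trans
          (add_le_add_right (measure_union_le _ _) _))
      _ ≤ _ := by rw [h₀, add_zero]; exact add_le_add_right hBle _
  rw [ENNReal.ofReal_sub _ hδ, ENNReal.ofReal_one]
  exact tsub_le_iff_right.2 h1

end Probability

end FiniteMDP

/-! ### Cells of a pair of discretized candidates. -/

section Discretization

variable {disc : ℝ → ℝ} {V η : ℝ}

/-- The cell of the partition induced by two discretized functions. -/
def pairCell {X : Type*} {V : ℝ} (disc : ℝ → ℝ) (q q' : X → ℝ) (hq : ∀ x, q x ∈ Set.Icc 0 V)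
    (hq' : ∀ x, q' x ∈ Set.Icc 0 V) (x : X) :
    (disc '' Set.Icc 0 V) × (disc '' Set.Icc 0 V) :=
  (⟨disc (q x), Set.mem_image_of_mem _ (hq x)⟩, ⟨disc (q' x), Set.mem_image_of_mem _ (hq' x)⟩)

lemma pairCell_eq_iff {X : Type*} {q q' : X → ℝ} {hq : ∀ x, q x ∈ Set.Icc 0 V}
    {hq' : ∀ x, q' x ∈ Set.Icc 0 V} {x y : X} :
    pairCell disc q q' hq hq' x = pairCell disc q q' hq hq' y ↔
      (disc (q x), disc (q' x)) = (disc (q y), disc (q' y)) := by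
  simp [pairCell]

lemma IsDiscretization.abs_sub_le_of_eq (h : IsDiscretization disc V η) {u v : ℝ}
    (hu : u ∈ Set.Icc 0 V) (hv : v ∈ Set.Icc 0 V) (huv : disc u = disc v) :
    |u - v| ≤ 2 * η := by
  have h1 := abs_le.1 (h.abs_sub_le u hu)
  have h2 := abs_le.1 (h.abs_sub_le v hv)
  rw [abs_le]
  constructor <;> linarith [h1.1, h1.2, h2.1, h2.2]

/-- Labelling cells by the finite image of `disc` instead of real pairs makes the number of cells
available for the union bound and for the additive error. -/
lemma pairClass_eq_piecewiseConst {S A : Type*} {L : ℕ} {Q : Fin L → S × A → ℝ}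
    (hQ : ∀ l x, Q l x ∈ Set.Icc 0 V) (i j : Fin L) :
    pairClass V disc Q i j =
      piecewiseConst V (pairCell disc (Q i) (Q j) (hQ i) (hQ j)) := by
  ext g
  simp only [pairClass, piecewiseConst, Set.mem_ofPred_eq, pairCell_eq_iff]

end Discretization

/-! ### Deterministic analysis of the output on accurate data. -/

namespace FiniteMDP

variable {S A : Type*} [Fintype S] [Fintype A] {M : FiniteMDP S A} {μ : PMF (S × A)} {C : ℝ}
  (π : S → PMF A)

lemma abs_sub_qPi_le_Vmax {q : S × A → ℝ} (hq : ∀ x, q x ∈ Set.Icc 0 M.Vmax) (x : S × A) :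
    |(q - M.qPi π) x| ≤ M.Vmax := by
  have h1 := hq x
  have h2 := M.qPi_mem_Icc π x
  rw [Pi.sub_apply, abs_le]
  constructor <;> linarith [h1.1, h1.2, h2.1, h2.2]

omit [Fintype S] [Fintype A] in
lemma empNorm_le_bvftLoss {L n : ℕ} (D : Fin n → S × A × ℝ × S) (Q : Fin L → S × A → ℝ)
    (T : Fin L → Fin L → S × A → ℝ) (i j : Fin L) :
    empNorm D (Q i - T i j) ≤ bvftLoss D Q T i :=
  le_ciSup (f := fun j => empNorm D (Q i - T i j)) (Set.finite_range _).bddAbove j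

/-- Performance of BVFT-PE on a dataset on which all cells are accurate. -/
lemma Coverage.wnorm_sub_qPi_le_of_output (hcov : M.Coverage μ C) {L : ℕ}
    {Q : Fin L → S × A → ℝ} (hQ : ∀ l x, Q l x ∈ Set.Icc 0 M.Vmax) {disc : ℝ → ℝ} {η τ : ℝ}
    (hη : 0 ≤ η) (hτ : 0 < τ) (hdisc : IsDiscretization disc M.Vmax η)
    [Fintype (disc '' Set.Icc 0 M.Vmax)] [DecidableEq (disc '' Set.Icc 0 M.Vmax)]
    {n : ℕ} (hn : 0 < n) {D : Fin n → S × A × ℝ × S}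
    (hr : ∀ k, (D k).2.2.1 = M.R (D k).1 (D k).2.1)
    (hD : ∀ i j c, M.IsCellAccurate μ π τ D
      (pairCell disc (Q i) (Q j) (hQ i) (hQ j)) (Q i) c)
    {l : Fin L} (hl : IsBVFTPEOutput M.γ M.Vmax disc π Q D l) (m : Fin L) {w : S × A → ℝ}
    (hw : ∀ x, 0 ≤ w x) (hw1 : ∑ x, w x = 1) (hwC : ∀ x, w x ≤ C * (μ x).toReal) :
    (1 - M.γ) * wnorm w (Q l - M.qPi π) ≤
      √C * (2 * η + √2 * (2 * η + √2 * (2 * ‖Q m - M.qPi π‖) +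
        5 * M.Vmax * √τ * Fintype.card (disc '' Set.Icc 0 M.Vmax)) +
        5 * M.Vmax * √τ * Fintype.card (disc '' Set.Icc 0 M.Vmax)) +
      (2 * ‖Q m - M.qPi π‖ + 2 * η) := by
  set N : ℝ := (Fintype.card (disc '' Set.Icc 0 M.Vmax) : ℝ) with hN
  set κ : ℝ := 5 * M.Vmax * √τ * N with hκ
  set p : S × A → ℝ := fun x => (μ x).toReal with hp
  have hp0 : ∀ x, 0 < p x := hcov.toReal_pos
  have hu := unifWeight_pos hn
  obtain ⟨x₀, -⟩ := μ.support_nonempty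
  have hV : 0 ≤ M.Vmax := (hQ l x₀).1.trans (hQ l x₀).2
  let φ : ∀ i j : Fin L, S × A → _ := fun i j => pairCell disc (Q i) (Q j) (hQ i) (hQ j)
  obtain ⟨T, hT, hmin⟩ := hl
  have htar : ∀ i k, dataTarget M.γ π D (Q i) k ∈ Set.Icc 0 M.Vmax := fun i k => by
    rw [dataTarget, hr k]
    exact target_mem_Icc (M := M) π (hQ i) (dataPair D k) _
  have hemp : ∀ i j, empNorm D (Q i - T i j) = wnorm (unifWeight n)
      (Q i ∘ dataPair D - cellAvg (unifWeight n) (φ i j ∘ dataPair D)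
        (dataTarget M.γ π D (Q i))) := fun i j => by
    have h := hT i j
    rw [pairClass_eq_piecewiseConst hQ] at h
    rw [empNorm_eq_wnorm, ← h.comp_dataPair hn hV (htar i)]
    rfl
  have hosc : ∀ i j x y, φ i j x = φ i j y → |Q i x - Q i y| ≤ 2 * η := fun i j x y h =>
    hdisc.abs_sub_le_of_eq (hQ i x) (hQ i y) (congrArg Prod.fst (pairCell_eq_iff.1 h))
  have hoscm : ∀ x y, φ l m x = φ l m y →
      |M.qPi π x - M.qPi π y| ≤ 2 * ‖Q m - M.qPi π‖ + 2 * η := fun x y h => by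
    have h1 := hdisc.abs_sub_le_of_eq (hQ m x) (hQ m y) (congrArg Prod.snd (pairCell_eq_iff.1 h))
    have h2 := norm_le_pi_norm (Q m - M.qPi π) x
    have h3 := norm_le_pi_norm (Q m - M.qPi π) y
    rw [Real.norm_eq_abs, Pi.sub_apply, abs_le] at h2 h3
    rw [abs_le] at h1 ⊢
    constructor <;> linarith [h1.1, h1.2, h2.1, h2.2, h3.1, h3.2]
  have habs : ∀ {a b : ℝ}, a ∈ Set.Icc 0 M.Vmax → b ∈ Set.Icc 0 M.Vmax → |a - b| ≤ M.Vmax := by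
    intro a b ha hb
    rw [abs_le]
    constructor <;> linarith [ha.1, ha.2, hb.1, hb.2]
  have hcmp := fun i j => wnorm_cellAvg_compare (w := p) (w' := unifWeight n) (ψ := φ i j)
    (ψ' := φ i j ∘ dataPair D) (f := Q i - M.bellman π (Q i))
    (f' := Q i ∘ dataPair D - dataTarget M.γ π D (Q i)) (fun x => (hp0 x).le)
    (unifWeight_nonneg n) hV hτ (fun x => habs (hQ i x) (bellman_mem_Icc π (hQ i) x))
    (fun k => habs (hQ i _) (htar i k)) (fun c => (hD i j c).1) (fun c => (hD i j c).2)
  have hcard : √(Fintype.card ((disc '' Set.Icc 0 M.Vmax) × (disc '' Set.Icc 0 M.Vmax)) : ℝ) = N := by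
    rw [Fintype.card_prod, Nat.cast_mul, Real.sqrt_mul_self (Nat.cast_nonneg _)]
  simp only [hcard] at hcmp
  -- From population to data, uniformly in `j`: the residual of `Q m` is small before any
  -- projection, so the choice of partition does not matter.
  have hmloss : bvftLoss D Q T m ≤ 2 * η + √2 * (2 * ‖Q m - M.qPi π‖) + κ := by
    have : Nonempty (Fin L) := ⟨m⟩
    refine ciSup_le fun j => ?_
    rw [hemp]
    have e1 := wnorm_sub_cellAvg_le (f := Q m ∘ dataPair D) (g := dataTarget M.γ π D (Q m))
      (ψ := φ m j ∘ dataPair D) hu (sum_unifWeight hn) (b := 2 * η) (by positivity)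
      fun i k h => hosc m j _ _ h
    have e2 := (hcmp m j).2
    have e3 : wnorm p (cellAvg p (φ m j) (Q m - M.bellman π (Q m))) ≤ 2 * ‖Q m - M.qPi π‖ :=
      (wnorm_cellAvg_le hp0).trans (wnorm_sub_bellman_le π (Q m))
    have e4 := mul_le_mul_of_nonneg_left e3 (Real.sqrt_nonneg 2)
    linarith
  -- The maximum in the loss of `l` is used only at `j = m`, the partition on which `hoscm` controls
  -- `Q^π`.
  have hlm : wnorm (unifWeight n) (cellAvg (unifWeight n) (φ l m ∘ dataPair D)
      (Q l ∘ dataPair D - dataTarget M.γ π D (Q l))) ≤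
        2 * η + √2 * (2 * ‖Q m - M.qPi π‖) + κ := by
    refine (wnorm_cellAvg_sub_le hu).trans ?_
    rw [← hemp]
    exact ((empNorm_le_bvftLoss D Q T l m).trans (hmin m)).trans hmloss
  have hpop : wnorm p (Q l - cellAvg p (φ l m) (M.bellman π (Q l))) ≤
      2 * η + √2 * (2 * η + √2 * (2 * ‖Q m - M.qPi π‖) + κ) + κ := by
    have e1 := wnorm_sub_cellAvg_le (f := Q l) (g := M.bellman π (Q l)) (ψ := φ l m) hp0
      (sum_toReal_pmf μ) (b := 2 * η) (by positivity) (hosc l m)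
    have e2 := (hcmp l m).1
    have e3 := mul_le_mul_of_nonneg_left hlm (Real.sqrt_nonneg 2)
    linarith
  refine (hcov.wnorm_sub_qPi_le π (Q l) (φ l m) (by positivity) hoscm hw hw1 hwC).trans ?_
  exact add_le_add_left (mul_le_mul_of_nonneg_left hpop (Real.sqrt_nonneg C)) _

end FiniteMDP

/-! ### Numerical constants and conclusion. -/

/-- The number of values of a discretization with resolution `ε Rmax / (8 √C)`. -/
lemma IsDiscretization.card_le {disc : ℝ → ℝ} {V R g ε C : ℝ} (hV : V = R / g) (hR : 0 < R) (hg : 0 < g) (hg1 : g ≤ 1)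
    (hε : 0 < ε) (hε1 : ε ≤ 1) (hC : 1 ≤ C)
    (h : IsDiscretization disc V (ε * R / (8 * √C)))
    [Fintype (disc '' Set.Icc 0 V)] :
    (Fintype.card (disc '' Set.Icc 0 V) : ℝ) ≤ 10 * √C / (ε * g) := by
  have hsC : 1 ≤ √C := Real.one_le_sqrt.2 hC
  have h1 : (Fintype.card (disc '' Set.Icc 0 V) : ℝ) ≤
      ⌈V / (ε * R / (8 * √C))⌉₊ + 1 := by
    rw [← Nat.card_eq_fintype_card, Nat.card_coe_set_eq]
    exact_mod_cast h.ncard_le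
  have h2 : V / (ε * R / (8 * √C)) = 8 * √C / (ε * g) := by
    rw [hV]; field_simp
  have h3 : (⌈8 * √C / (ε * g)⌉₊ : ℝ) < 8 * √C / (ε * g) + 1 :=
    Nat.ceil_lt_add_one (by positivity)
  have h4 : 1 ≤ √C / (ε * g) := by
    rw [le_div_iff₀ (by positivity), one_mul]
    exact (mul_le_one₀ hε1 hg.le hg1).trans hsC
  rw [h2] at h1
  have e1 : 8 * √C / (ε * g) = 8 * (√C / (ε * g)) := by ring
  have e2 : 10 * √C / (ε * g) = 10 * (√C / (ε * g)) := by ring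
  rw [e1] at h1 h3
  rw [e2]
  linarith

/-- The union bound over all cells for the sample size of the theorem. -/
lemma card_mul_exp_le {g ε δ C N L n : ℝ} (hg : 0 < g) (hε : 0 < ε)
    (hδ : 0 < δ) (hδ1 : δ ≤ 1) (hC : 1 ≤ C) (hN0 : 0 ≤ N) (hN : N ≤ 10 * √C / (ε * g)) (hL : 1 ≤ L)
    (hn : 2000000 * C ^ 2 * Real.log (2000000 * √C * L / (ε * g * δ)) / (ε ^ 4 * g ^ 4) ≤ n) :
    L ^ 2 * N ^ 2 * (4 * Real.exp (-(n * (ε ^ 2 * g ^ 2 / (1000 * C)) ^ 2))) ≤ δ := by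
  have hsC : 0 < √C := Real.sqrt_pos.2 (by linarith)
  set z := 2000000 * √C * L / (ε * g * δ) with hz
  have hz0 : 0 < z := by positivity
  -- The `2` is `2000000 / 1000²`; it makes the exponential at most `z⁻²`, which absorbs the factor
  -- `L² N²` of the union bound.
  have h1 : 2 * Real.log z ≤ n * (ε ^ 2 * g ^ 2 / (1000 * C)) ^ 2 := by
    refine le_trans (le_of_eq ?_) (mul_le_mul_of_nonneg_right hn (sq_nonneg _))
    field_simp
    ring
  have h2 : Real.exp (-(n * (ε ^ 2 * g ^ 2 / (1000 * C)) ^ 2)) ≤ (z ^ 2)⁻¹ := by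
    refine (Real.exp_le_exp.2 (neg_le_neg h1)).trans (le_of_eq ?_)
    rw [Real.exp_neg, two_mul, Real.exp_add, Real.exp_log hz0, sq]
  calc L ^ 2 * N ^ 2 * (4 * Real.exp (-(n * (ε ^ 2 * g ^ 2 / (1000 * C)) ^ 2)))
      ≤ L ^ 2 * (10 * √C / (ε * g)) ^ 2 * (4 * (z ^ 2)⁻¹) := by gcongr
    _ = 1 / 10 ^ 10 * δ ^ 2 := by
        rw [hz]
        field_simp
        norm_num
    _ ≤ δ := by nlinarith

/-- The two factors `√2`, one for each passage between data and population, multiply to `2` and give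
`4√C`. The multiples of `ε R` are at most `4.84/8` (rounding inside the residual), `2.42/20`
(sampling) and `1/4` (oscillation of `Q^π`), which total less than `1`. -/
lemma error_le {R g ε C N E : ℝ} (hR : 0 < R) (hg : 0 < g) (hε : 0 < ε) (hC : 1 ≤ C)
    (hN0 : 0 ≤ N) (hN : N ≤ 10 * √C / (ε * g)) :
    √C * (2 * (ε * R / (8 * √C)) + √2 * (2 * (ε * R / (8 * √C)) + √2 * (2 * E) +
        5 * (R / g) * (ε ^ 2 * g ^ 2 / (1000 * C)) * N) +
        5 * (R / g) * (ε ^ 2 * g ^ 2 / (1000 * C)) * N) +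
      (2 * E + 2 * (ε * R / (8 * √C))) ≤ ε * R + (2 + 4 * √C) * E := by
  have hsC : 1 ≤ √C := Real.one_le_sqrt.2 hC
  have hsC0 : 0 < √C := by linarith
  have hCC : √C * √C = C := Real.mul_self_sqrt (by linarith)
  set κ := 5 * (R / g) * (ε ^ 2 * g ^ 2 / (1000 * C)) * N with hκ
  set η := ε * R / (8 * √C) with hη
  have h22 : √2 * √2 = 2 := Real.mul_self_sqrt zero_le_two
  have h2 : √2 ≤ 1.42 := by
    rw [Real.sqrt_le_left (by norm_num)]
    norm_num
  have h20 : 0 ≤ √2 := Real.sqrt_nonneg 2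
  have hη0 : 0 < η := by positivity
  have hκ0 : 0 ≤ κ := by positivity
  have hηC : √C * η = ε * R / 8 := by rw [hη]; field_simp
  have hη1 : η ≤ ε * R / 8 := by
    rw [← hηC]; exact le_mul_of_one_le_left hη0.le hsC
  have hκC : √C * κ ≤ ε * R / 20 := by
    calc √C * κ ≤ √C * (5 * (R / g) * (ε ^ 2 * g ^ 2 / (1000 * C)) * (10 * √C / (ε * g))) := by
          rw [hκ]; gcongr
      _ = √C * √C / C * (ε * R / 20) := by
          field_simp
          norm_num
      _ = ε * R / 20 := by rw [hCC, div_self (by linarith), one_mul]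
  have e : √C * (2 * η + √2 * (2 * η + √2 * (2 * E) + κ) + κ) =
      (2 + 2 * √2) * (√C * η) + (√2 * √2) * (2 * √C * E) + (1 + √2) * (√C * κ) := by ring
  rw [e, h22, hηC]
  have hεR : 0 < ε * R := by positivity
  have f1 : (1 + √2) * (√C * κ) ≤ 2.42 * (ε * R / 20) :=
    mul_le_mul (by linarith) hκC (by positivity) (by norm_num)
  have f2 : (2 + 2 * √2) * (ε * R / 8) ≤ 4.84 * (ε * R / 8) :=
    mul_le_mul_of_nonneg_right (by linarith) (by positivity)
  linarith

lemma l2norm_eq_wnorm {X : Type*} [Fintype X] (ν : PMF X) (f : X → ℝ) :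
    l2norm ν f = wnorm (fun x => (ν x).toReal) f := rfl

theorem theorem1 :
    ∃ K : ℝ, 0 < K ∧
      ∀ (S A : Type*) [Fintype S] [Fintype A]
        [MeasurableSpace S] [MeasurableSingletonClass S]
        [MeasurableSpace A] [MeasurableSingletonClass A]
        (M : FiniteMDP S A) (μ : PMF (S × A)) (C : ℝ), M.Coverage μ C →
      ∀ (π : S → PMF A) (L : ℕ), 1 ≤ L →
      ∀ Q : Fin L → S × A → ℝ, (∀ l x, Q l x ∈ Set.Icc 0 M.Vmax) →
      ∀ ε δ : ℝ, 0 < ε → 0 < δ → δ < 1 →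
      ∀ disc : ℝ → ℝ, IsDiscretization disc M.Vmax (ε * M.Rmax / (8 * √C)) →
      ∀ n : ℕ,
        K * C ^ 2 * Real.log (K * √C * L / (ε * (1 - M.γ) * δ)) / (ε ^ 4 * (1 - M.γ) ^ 4) ≤ n →
        ENNReal.ofReal (1 - δ) ≤ M.dataLaw μ n
          {D | ∀ l : Fin L, IsBVFTPEOutput M.γ M.Vmax disc π Q D l →
            ∀ ν : PMF (S × A), (∀ x, (ν x).toReal / (μ x).toReal ≤ C) →
              l2norm ν (Q l - M.qPi π) ≤
                ε * (M.Rmax / (1 - M.γ)) +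
                  (2 + 4 * √C) * (⨅ l' : Fin L, ‖Q l' - M.qPi π‖) / (1 - M.γ)} := by

  refine ⟨2000000, by norm_num, ?_⟩
  intro S A _ _ _ _ _ _ M μ C hcov π L hL Q hQ ε δ hε hδ hδ1 disc hdisc n hn
  classical
  have hg : 0 < 1 - M.γ := sub_pos.2 M.γ_lt_one
  have hg1 : 1 - M.γ ≤ 1 := by linarith [M.γ_nonneg]
  have hC := hcov.one_le
  have hR := M.Rmax_nonneg μ
  have hV : 0 ≤ M.Vmax := div_nonneg hR hg.le
  have : Nonempty (Fin L) := ⟨⟨0, hL⟩⟩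
  have hE : 0 ≤ ⨅ l' : Fin L, ‖Q l' - M.qPi π‖ := Real.iInf_nonneg fun _ => norm_nonneg _
  -- Here the trivial bound `Vmax` on the error suffices for any dataset. Otherwise `ε ≤ 1` and
  -- `Rmax > 0`, as the counting of cells and the positivity of `n` require.
  by_cases htriv : M.Vmax ≤ ε * M.Vmax
  · refine le_trans (b := M.dataLaw μ n Set.univ) ?_ (measure_mono fun D _ l _ ν _ => ?_)
    · rw [measure_univ, ← ENNReal.ofReal_one]
      exact ENNReal.ofReal_le_ofReal (by linarith)
    · have h1 : l2norm ν (Q l - M.qPi π) ≤ M.Vmax :=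
        wnorm_le_of_abs_le (fun _ => ENNReal.toReal_nonneg) (sum_toReal_pmf ν) hV
          (M.abs_sub_qPi_le_Vmax π (hQ l))
      have h2 : 0 ≤ (2 + 4 * √C) * (⨅ l' : Fin L, ‖Q l' - M.qPi π‖) / (1 - M.γ) := by positivity
      exact h1.trans (htriv.trans (le_add_of_nonneg_right h2))
  have hV0 : 0 < M.Vmax := lt_of_le_of_ne hV fun h => htriv (by simp [← h])
  have hε1 : ε ≤ 1 := by
    by_contra! h
    exact htriv (le_mul_of_one_le_left hV h.le)
  have hR0 : 0 < M.Rmax := lt_of_le_of_ne hR fun h => hV0.ne' (by rw [FiniteMDP.Vmax, ← h, zero_div])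
  have : Fintype (disc '' Set.Icc 0 M.Vmax) := hdisc.finite.fintype
  have hN := IsDiscretization.card_le (V := M.Vmax) rfl hR0 hg hg1 hε hε1 hC hdisc
  have hL1 : (1 : ℝ) ≤ L := Nat.one_le_cast.2 hL
  have hsC : 1 ≤ √C := Real.one_le_sqrt.2 hC
  have hn0 : 0 < n := by
    have hlog : 0 < Real.log (2000000 * √C * L / (ε * (1 - M.γ) * δ)) := by
      refine Real.log_pos ?_
      rw [lt_div_iff₀ (by positivity), one_mul]
      have h1 : ε * (1 - M.γ) * δ ≤ 1 :=
        mul_le_one₀ (mul_le_one₀ hε1 hg.le hg1) hδ.le hδ1.le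
      have h2 : 1 ≤ √C * L := one_le_mul_of_one_le_of_one_le hsC hL1
      linarith only [h1, h2]
    have : (0 : ℝ) < n := lt_of_lt_of_le (by positivity) hn
    exact Nat.cast_pos.1 this
  -- The deviation level is `τ = t²`, so that `√τ = t`; with `N ≤ 10√C/(ε(1-γ))` the sampling error
  -- `√C · 5 Vmax t N` is at most `ε Rmax / 20`.
  set t := ε ^ 2 * (1 - M.γ) ^ 2 / (1000 * C) with ht
  have ht0 : 0 < t := by positivity
  have hprob := card_mul_exp_le hg hε hδ hδ1.le hC (Nat.cast_nonneg _) hN hL1 hn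
  refine (FiniteMDP.le_measure_forall_isCellAccurate (ι := Fin L × Fin L) (n := n) (μ := μ)
    (τ := t ^ 2) (δ := δ) π hV0 (fun i x => hQ i.1 x)
    (fun i => pairCell disc (Q i.1) (Q i.2) (hQ i.1) (hQ i.2)) (by positivity) hn0 hδ.le ?_).trans
    (measure_mono ?_)
  · rw [Fintype.card_prod, Fintype.card_prod, Fintype.card_fin]
    push_cast
    rw [← sq, ← sq]
    exact hprob
  rintro D ⟨hr, hD⟩ l hl ν hν
  obtain ⟨m, hm⟩ := exists_eq_ciInf_of_finite (f := fun l' : Fin L => ‖Q l' - M.qPi π‖)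
  have h := hcov.wnorm_sub_qPi_le_of_output π hQ (τ := t ^ 2) (by positivity) (by positivity)
    hdisc hn0 hr (fun i j c => hD (i, j) c) hl m (w := fun x => (ν x).toReal)
    (fun _ => ENNReal.toReal_nonneg) (sum_toReal_pmf ν)
    fun x => (div_le_iff₀ (hcov.toReal_pos x)).1 (hν x)
  rw [Real.sqrt_sq ht0.le] at h
  have h' := h.trans (error_le hR0 hg hε hC (Nat.cast_nonneg _) hN)
  rw [← hm, l2norm_eq_wnorm, ← mul_div_assoc, ← add_div, le_div_iff₀ hg, mul_comm]
  exact h'
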